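/- **Setting.** Let $H^2$ be the Hardy space on the unit circle $\mathbb T$, $P:L^2(\mathbb T)\to H^2$ the orthogonal projection, $z^0\in H^2$ the constant function $1$, $Sf=zf$ the shift on $H^2$ and $S^*$ its adjoint; inner products are linear in the first argument. Let $\mathrm{BMOA}(\mathbb T)$ be the set of $u\in H^2$ of bounded mean oscillation (the means $\frac1{|I|}\int_I|u-u_I|$ over arcs $I$, with $u_I$ the mean of $u$ over $I$, are bounded); it is well known that these are exactly the $u\in H^2$ for which the anti-linear Hankel operator $H_uf=P(u\overline f)$, defined on polynomials $f$, extends to a bounded operator on $H^2$. Put $\widetilde H_u=H_uS=S^*H_u$, $X_u=\overline{\operatorname{Ran}}\,H_u$ (invariant under $H_u$, $\widetilde H_u$ and $S^*$), $H_u^{e}=H_u|_{X_u}$, $\widetilde H_u^{e}=\widetilde H_u|_{X_u}$, $|H_u|=(H_u^2)^{1/2}$, $|\widetilde H_u|=(\widetilde H_u^2)^{1/2}$. A bounded self-adjoint operator $A$ on $X$ has simple spectrum if $X=\overline{\operatorname{span}}\{A^nv:n\ge0\}$ for some $v\in X$. Let $\mathrm{BMOA}_{\rm simp}$ be the set of $u\in\mathrm{BMOA}(\mathbb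 T)$ such that $(H_u^{e})^2$ and $(\widetilde H_u^{e})^2$ have simple spectrum. For a bounded self-adjoint operator $A$, the spectral measure $\rho_v^A$ is the measure on $\mathbb R$ with $\langle f(A)v,v\rangle=\int f\,d\rho_v^A$ for all continuous $f$. **Spectral data.** A spectral datum is a triple $(\rho,\Psi,\widetilde\Psi)$, where $\rho$ is a finite Borel measure with bounded support on $(0,\infty)$, $\int s^{-2}d\rho(s)\le1$, and $\Psi\in L^\infty(\rho)$, $\widetilde\Psi\in L^\infty(\widetilde\rho|_{(0,\infty)})$ are unimodular. Here $\widetilde\rho=\rho_{\mathbb 1}^{\widetilde{\mathcal M}}$, where $\mathcal M$ is multiplication by $s$ in $L^2(\rho)$, $\mathbb 1\in L^2(\rho)$ is the constant function $1$ and $\widetilde{\mathcal M}=(\mathcal M^2-\langle\cdot,\mathbb 1\rangle\mathbb 1)^{1/2}$. The spectral datum $\Lambda(u)=(\rho,\Psi_u,\widetilde\Psi_u)$ of $u\in\mathrm{BMOA}_{\rm simp}$ is given by: $\rho=\rho_u^{|H_u|}$ and $\widetilde\rho=\rho_u^{|\widetilde H_u|}$; the maps $Uf=f(|H_u|)u$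 and $\widetilde Uf=f(|\widetilde H_u|)u$ (defined on polynomials $f$ and extended by continuity) are unitary from $L^2(\rho)$, respectively $L^2(\widetilde\rho)$, onto $X_u$; and $$U^*H_u^{e}Uf(s)=s\,\overline{\Psi_u(s)}\,\overline{f(s)},\qquad \widetilde U^*\widetilde H_u^{e}\widetilde Uf(s)=s\,\widetilde\Psi_u(s)\,\overline{f(s)}.$$ **Theorem.** Every $u\in\mathrm{BMOA}_{\rm simp}$ has exactly one spectral datum $\Lambda(u)$, and $u$ is uniquely determined by it: the spectral map $u\mapsto\Lambda(u)$ on $\mathrm{BMOA}_{\rm simp}$ is injective. Explicitly, for $u\in\mathrm{BMOA}_{\rm simp}$ with $\Lambda(u)=(\rho,\Psi_u,\widetilde\Psi_u)$, let $\Sigma^*=U^*(S^*|_{X_u})U$ on $L^2(\rho)$ and $q(s)=\overline{\Psi_u(s)}/s$. Then $q\in L^2(\rho)$; the operator $\Sigma^*$ is determined by the spectral datum, being the continuous extension to $L^2(\rho)$ of the densely defined operator $$\widetilde\Psi_u(\widetilde{\mathcal M})\,\widetilde{\mathcal M}\,\mathcal M^{-1}\,\Psi_u(\mathcal M);$$ and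 $$\widehat u_k=\langle(\Sigma^*)^k\mathbb 1,q\rangle_{L^2(\rho)}\quad(k\ge0),\qquad u(z)=\sum_{k\ge0}\widehat u_kz^k=\langle(I-z\Sigma^*)^{-1}\mathbb 1,q\rangle_{L^2(\rho)}\quad(|z|<1),$$ where $I-z\Sigma^*$ is invertible for $|z|<1$. -/

import Mathlib

open MeasureTheory Filter Topology Polynomial
open scoped ENNReal ComplexConjugate InnerProductSpace

noncomputable section

namespace HankelInverse

/-! ### The Hardy space and the shift -/

/-- The unit circle, parametrised as `ℝ / ℤ`; the coordinate is `z = e^{2πit} = fourier 1 t`. -/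
abbrev Circ : Type := UnitAddCircle

/-- Normalised Lebesgue (Haar) measure on the circle. -/
abbrev mT : Measure Circ := AddCircle.haarAddCircle

/-- `L²(𝕋)`. -/
abbrev L2T : Type := Lp ℂ 2 mT

/-- The Hardy space `H²(𝕋)`: the functions in `L²(𝕋)` whose Fourier coefficients of negative
index vanish. -/
def H2 : Submodule ℂ L2T where
  carrier := {f | ∀ n : ℤ, n < 0 → fourierCoeff f n = 0}
  add_mem' := by
    intro f g hf hg n hn
    have h1 := hf n hn
    have h2 := hg n hn
    rw [← fourierBasis_repr] at h1 h2 ⊢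
    rw [map_add, lp.coeFn_add, Pi.add_apply, h1, h2, add_zero]
  zero_mem' := by
    intro n _
    rw [← fourierBasis_repr, map_zero, lp.coeFn_zero, Pi.zero_apply]
  smul_mem' := by
    intro c f hf n hn
    have h1 := hf n hn
    rw [← fourierBasis_repr] at h1 ⊢
    rw [map_smul, lp.coeFn_smul, Pi.smul_apply, h1, smul_zero]

theorem mem_H2 {f : L2T} : f ∈ H2 ↔ ∀ n : ℤ, n < 0 → fourierCoeff f n = 0 := Iff.rfl

theorem isClosed_H2 : IsClosed (H2 : Set L2T) := by
  have h : (H2 : Set L2T) = ⋂ (n : ℤ) (_ : n < 0),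
      {f : L2T | inner ℂ (fourierLp 2 n : L2T) f = 0} := by
    ext f
    simp only [SetLike.mem_coe, mem_H2, Set.mem_iInter, Set.mem_ofPred_eq]
    refine forall_congr' fun n => forall_congr' fun _ => ?_
    rw [← fourierBasis_repr, HilbertBasis.repr_apply_apply, coe_fourierBasis]
  rw [h]
  exact isClosed_iInter fun n => isClosed_iInter fun _ =>
    isClosed_eq (continuous_const.inner continuous_id) continuous_const

instance : CompleteSpace H2 := isClosed_H2.completeSpace_coe

/-- The `k`-th Fourier (Taylor) coefficient `û_k` of `u ∈ H²`. -/
def hatCoeff (u : H2) (k : ℕ) : ℂ := fourierCoeff (u : L2T) (k : ℤ)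

/-- Multiplication by `φ ∈ L^∞(μ)` as a bounded operator on `L²(μ)`. -/
def mulOp {α : Type*} [MeasurableSpace α] {μ : Measure α} (φ : Lp ℂ ∞ μ) :
    Lp ℂ 2 μ →L[ℂ] Lp ℂ 2 μ :=
  (ContinuousLinearMap.mul ℂ ℂ).holderL μ ∞ 2 2 φ

theorem coeFn_mulOp {α : Type*} [MeasurableSpace α] {μ : Measure α} (φ : Lp ℂ ∞ μ)
    (f : Lp ℂ 2 μ) : mulOp φ f =ᵐ[μ] fun x => φ x * f x :=
  (ContinuousLinearMap.mul ℂ ℂ).coeFn_holder φ f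

/-- Multiplication by `z` on `L²(𝕋)`. -/
def mulZ : L2T →L[ℂ] L2T := mulOp (fourierLp ∞ 1)

theorem fourierCoeff_mulZ (f : L2T) (n : ℤ) :
    fourierCoeff (mulZ f) n = fourierCoeff f (n - 1) := by
  unfold fourierCoeff
  refine integral_congr_ae ?_
  filter_upwards [coeFn_mulOp (fourierLp ∞ 1) f, coeFn_fourierLp (T := 1) ∞ 1] with t h1 h2
  rw [mulZ, h1, h2]
  have : -(n - 1) = -n + 1 := by ring
  rw [this, fourier_add, smul_eq_mul, smul_eq_mul, mul_assoc]

/-- The shift operator `S f = z f` on `H²`. -/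
def shift : H2 →L[ℂ] H2 :=
  (mulZ.comp H2.subtypeL).codRestrict H2 fun f n hn => by
    change fourierCoeff (mulZ (f : L2T)) n = 0
    rw [fourierCoeff_mulZ]
    exact f.2 (n - 1) (by omega)

/-- The backward shift `S*`. -/
def backShift : H2 →L[ℂ] H2 := ContinuousLinearMap.adjoint shift

/-- The non-negative square root `T^{1/2}` of a bounded non-negative operator. -/
def opSqrt {E : Type*} [NormedAddCommGroup E] [InnerProductSpace ℂ E] [CompleteSpace E]
    (T : E →L[ℂ] E) : E →L[ℂ] E := cfc Real.sqrt T

/-! ### BMOA and anti-linear Hankel operators -/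

/-- `u ∈ H²` is of bounded mean oscillation on the circle: the mean oscillations over all arcs
are bounded. The arcs of the circle are exactly the metric balls. -/
def IsBMOA (u : H2) : Prop :=
  ∃ C : ℝ, ∀ (x : Circ) (r : ℝ), 0 < r →
    ⨍ t in Metric.ball x r, ‖(u : L2T) t - ⨍ s in Metric.ball x r, (u : L2T) s ∂mT‖ ∂mT ≤ C

/-- `H` is the (bounded, anti-linear) Hankel operator `H_u`: `H_u f = P (u f̄)` for all analytic
polynomials `f`, where `P` is the orthogonal projection of `L²(𝕋)` onto `H²`. -/
def IsHankel (u : H2) (H : H2 →SL[starRingEnd ℂ] H2) : Prop :=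
  ∀ (p : ℂ[X]) (f : H2) (g : L2T),
    ((f : L2T) =ᵐ[mT] fun t => p.eval (fourier 1 t)) →
    (g =ᵐ[mT] fun t => (u : L2T) t * conj ((f : L2T) t)) →
    H f = H2.orthogonalProjectionOnto g

/-- The truncated Hankel operator `H̃_u = H_u S`. -/
def truncated (H : H2 →SL[starRingEnd ℂ] H2) : H2 →SL[starRingEnd ℂ] H2 := H.comp shift

/-- The (linear) square `A²` of a bounded anti-linear operator. -/
def sqOp (A : H2 →SL[starRingEnd ℂ] H2) : H2 →L[ℂ] H2 := A.comp A

/-- The modulus `|A| = (A²)^{1/2}` of a (symmetric) anti-linear operator. -/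
def modulus (A : H2 →SL[starRingEnd ℂ] H2) : H2 →L[ℂ] H2 := opSqrt (sqOp A)

/-- The closure of the range of `H`. -/
def ranClosure (H : H2 →SL[starRingEnd ℂ] H2) : Submodule ℂ H2 :=
  (LinearMap.range (H : H2 →ₛₗ[starRingEnd ℂ] H2)).topologicalClosure

/-- The cyclic subspace `clos span {Tⁿ v : n ≥ 0}`. -/
def cyclicSubspace {E : Type*} [NormedAddCommGroup E] [NormedSpace ℂ E] (T : E →L[ℂ] E) (v : E) :
    Submodule ℂ E :=
  (Submodule.span ℂ (Set.range fun n : ℕ => (T ^ n) v)).topologicalClosure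

/-- The restriction of `T` to its closed invariant subspace `X` has simple spectrum. -/
def SimpleSpectrumOn {E : Type*} [NormedAddCommGroup E] [NormedSpace ℂ E] (T : E →L[ℂ] E)
    (X : Submodule ℂ E) : Prop :=
  ∃ v ∈ X, cyclicSubspace T v = X

/-- The class `BMOA_simp(𝕋)`: the `u ∈ BMOA` with (bounded) Hankel operator `H_u` such that the
squares of `H_u` and of `H̃_u`, restricted to the closure of the range of `H_u`, have simple
spectrum. -/
def BMOASimp : Set H2 :=
  {u | IsBMOA u ∧ ∃ H, IsHankel u H ∧
    SimpleSpectrumOn (sqOp H) (ranClosure H) ∧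
    SimpleSpectrumOn (sqOp (truncated H)) (ranClosure H)}

/-! ### Spectral measures -/

section Spectral

variable {E : Type*} [NormedAddCommGroup E] [InnerProductSpace ℂ E] [CompleteSpace E]

/-- The positive functional `f ↦ ⟨f(T) v, v⟩` on `C_c(ℝ)`. -/
def spectralFunctional (T : E →L[ℂ] E) (v : E) :
    CompactlySupportedContinuousMap ℝ ℝ →ₚ[ℝ] ℝ :=
  PositiveLinearMap.mk₀
    { toFun := fun f => (inner ℂ v (cfc (f : ℝ → ℝ) T v)).re
      map_add' := by
        intro f g
        have : cfc ((f + g : CompactlySupportedContinuousMap ℝ ℝ) : ℝ → ℝ) T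
            = cfc (f : ℝ → ℝ) T + cfc (g : ℝ → ℝ) T :=
          cfc_add (R := ℝ) (a := T) (f := f) (g := g)
            (hf := f.continuous.continuousOn) (hg := g.continuous.continuousOn)
        rw [this, _root_.add_apply, inner_add_right, Complex.add_re]
      map_smul' := by
        intro c f
        have : cfc ((c • f : CompactlySupportedContinuousMap ℝ ℝ) : ℝ → ℝ) T
            = c • cfc (f : ℝ → ℝ) T :=
          cfc_smul (R := ℝ) (a := T) c (f : ℝ → ℝ) (hf := f.continuous.continuousOn)
        rw [this, _root_.smul_apply, RCLike.real_smul_eq_coe_smul (K := ℂ),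
          inner_smul_right]
        simp }
    (by
      intro f hf
      have h0 : (0 : E →L[ℂ] E) ≤ cfc (f : ℝ → ℝ) T := cfc_nonneg fun x _ => hf x
      have h1 := (ContinuousLinearMap.nonneg_iff_isPositive _).1 h0
      simpa using (Complex.le_def.1 (h1.inner_nonneg_right v)).1)

/-- The spectral measure `ρ_v^T` of a bounded self-adjoint operator `T`: the measure on `ℝ` with
`⟨f(T) v, v⟩ = ∫ f dρ_v^T` for continuous `f`. -/
def spectralMeasure (T : E →L[ℂ] E) (v : E) : Measure ℝ :=
  RealRMK.rieszMeasure (spectralFunctional T v)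

end Spectral

/-- The unitary `U f = f(T) v` from `L²(ρ)` onto a subspace `X`: it is defined by this formula on
polynomials. -/
def IsSpectralUnitary {E : Type*} [NormedAddCommGroup E] [InnerProductSpace ℂ E]
    (T : E →L[ℂ] E) (v : E) {ρ : Measure ℝ} {X : Submodule ℂ E}
    (U : Lp ℂ 2 ρ ≃ₗᵢ[ℂ] X) : Prop :=
  ∀ (p : ℂ[X]) (f : Lp ℂ 2 ρ), (f =ᵐ[ρ] fun s => p.eval (s : ℂ)) →
    (U f : E) = aeval T p v

/-! ### Spectral data -/

open Classical in
/-- Multiplication by the independent variable in `L²(ρ)`; meaningful when `ρ` has bounded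
support. -/
def opM (ρ : Measure ℝ) : Lp ℂ 2 ρ →L[ℂ] Lp ℂ 2 ρ :=
  if h : MemLp (fun s : ℝ => (s : ℂ)) ∞ ρ then mulOp h.toLp else 0

/-- The function `𝟙` in `L²(ρ)`. -/
def oneL2 (ρ : Measure ℝ) [IsFiniteMeasure ρ] : Lp ℂ 2 ρ := Lp.const 2 ρ (1 : ℂ)

/-- `M̃ = (M² - ⟨·, 𝟙⟩ 𝟙)^{1/2}`. -/
def opMt (ρ : Measure ℝ) [IsFiniteMeasure ρ] : Lp ℂ 2 ρ →L[ℂ] Lp ℂ 2 ρ :=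
  opSqrt (opM ρ ^ 2 - InnerProductSpace.rankOne ℂ (oneL2 ρ) (oneL2 ρ))

/-- The measure `ρ̃` determined by `ρ`: the spectral measure of `M̃` and the vector `𝟙`. -/
@[irreducible] def rhoTilde (ρ : Measure ℝ) [IsFiniteMeasure ρ] : Measure ℝ := spectralMeasure (opMt ρ) (oneL2 ρ)

/-- (Abstract) spectral data `(ρ, Ψ, Ψ̃)`: a finite Borel measure `ρ` with bounded support on
`(0, ∞)` and `∫ s⁻² dρ(s) ≤ 1`, and unimodular functions `Ψ ∈ L^∞(ρ)` and `Ψ̃ ∈ L^∞(ρ̃₀)`, where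
`ρ̃₀` is the restriction of `ρ̃` to `(0, ∞)`. -/
structure SpectralDatum where
  ρ : Measure ℝ
  [finite : IsFiniteMeasure ρ]
  pos : ρ (Set.Iic 0) = 0
  bounded : ∃ R : ℝ, ρ (Set.Ioi R) = 0
  normalized : ∫⁻ s, ENNReal.ofReal (1 / s ^ 2) ∂ρ ≤ 1
  Ψ : Lp ℂ ∞ ρ
  unimodular : ∀ᵐ s ∂ρ, ‖Ψ s‖ = 1
  Ψt : Lp ℂ ∞ ((rhoTilde ρ).restrict (Set.Ioi 0))
  unimodular_t : ∀ᵐ s ∂((rhoTilde ρ).restrict (Set.Ioi 0)), ‖Ψt s‖ = 1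

attribute [instance] SpectralDatum.finite

/-- `D` is the spectral datum `Λ(u)`. With `X` the closure of the range of `H_u`:
`ρ` and `ρ̃` are the spectral measures of `|H_u|` and `|H̃_u|` with respect to `u`; the unitary
operators `U : L²(ρ) → X`, `U f = f(|H_u|) u`, and `Ũ : L²(ρ̃) → X`, `Ũ f = f(|H̃_u|) u`, transform
`H_u` on `X` into `f ↦ s Ψ̄(s) f̄(s)` and `H̃_u` on `X` into `f ↦ s Ψ̃(s) f̄(s)`. (The value of
`Ψ̃` at `s = 0` plays no role.) -/
def IsSpectralDatum (u : H2) (D : SpectralDatum) : Prop :=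
  ∃ (H : H2 →SL[starRingEnd ℂ] H2) (U : Lp ℂ 2 D.ρ ≃ₗᵢ[ℂ] ranClosure H)
    (Ut : Lp ℂ 2 (rhoTilde D.ρ) ≃ₗᵢ[ℂ] ranClosure H),
    IsHankel u H ∧
    D.ρ = spectralMeasure (modulus H) u ∧
    rhoTilde D.ρ = spectralMeasure (modulus (truncated H)) u ∧
    IsSpectralUnitary (modulus H) u U ∧
    IsSpectralUnitary (modulus (truncated H)) u Ut ∧
    (∀ f g : Lp ℂ 2 D.ρ, (g =ᵐ[D.ρ] fun s => (s : ℂ) * conj (D.Ψ s) * conj (f s)) →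
      H (U f) = U g) ∧
    (∀ f g : Lp ℂ 2 (rhoTilde D.ρ),
      (g =ᵐ[rhoTilde D.ρ] fun s => (s : ℂ) * D.Ψt s * conj (f s)) →
      truncated H (Ut f) = Ut g)

/-- `A = Ψ̃(M̃) M̃ M⁻¹ Ψ(M)`, extended by continuity from the range of `M`: that is,
`A (M f) = Ψ̃(M̃) M̃ (Ψ f)` for all `f ∈ L²(ρ)`. Here functions of `M̃` are defined through its
spectral representation `V : L²(ρ̃) → L²(ρ)`, `V f = f(M̃) 𝟙`, as `φ(M̃) V h = V (φ h)`. -/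
def IsModelContraction (D : SpectralDatum) (A : Lp ℂ 2 D.ρ →L[ℂ] Lp ℂ 2 D.ρ) : Prop :=
  ∃ V : Lp ℂ 2 (rhoTilde D.ρ) ≃ₗᵢ[ℂ] (⊤ : Submodule ℂ (Lp ℂ 2 D.ρ)),
    IsSpectralUnitary (opMt D.ρ) (oneL2 D.ρ) V ∧
    ∀ (f : Lp ℂ 2 D.ρ) (h g : Lp ℂ 2 (rhoTilde D.ρ)),
      (V h : Lp ℂ 2 D.ρ) = mulOp D.Ψ f →
      (g =ᵐ[rhoTilde D.ρ] fun s => (s : ℂ) * D.Ψt s * h s) →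
      A (opM D.ρ f) = V g

end HankelInverse

end

open HankelInverse

/-! Three identities drive everything: `H 1 = u`, `H S = S* H` and the symmetry `⟨H f, g⟩ = ⟨H g,
f⟩`. All follow from `IsHankel.inner_orbitMap`, where the pairing depends only on the product of two
polynomials. With `S S* = I - ⟨·, 1⟩ 1` they give the rank-one identity `H̃² = H² - ⟨·, u⟩ u`
(`IsHankel.sqOp_truncated`).

Existence of the datum rests on the cyclicity of `u`. Let `Y` be the cyclic subspace of `H²` at `u`;
it is invariant under `H²` and `H̃²`. Simple spectrum forces it to be invariant under the
anti-linear `H` and `H̃` too (`IsConjSymmetric.map_mem_of_simple`). Then `Z = X ⊖ Y` is invariant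
under both, `H` has dense range in `Z`, so `Z` is invariant under `S*` and orthogonal to `1`. All
Taylor coefficients of its elements vanish, hence `Z = 0` (`IsHankel.cyclicSubspace_sqOp`). The
spectral theorem now yields `U` and `Ũ`. Since `H` commutes with `|H|`, it becomes `f ↦ φ f̄` with
`|φ| = s` (`IsConjSymmetric.exists_symbol`), and likewise for `H̃`.

For the inversion, `q = U⁻¹ P_X 1` solves `H U q = u`, that is `s Ψ̄ q̄ = 1`, so `q = Ψ̄ / s`. From
`S* H = H̃` and `M f = U⁻¹ H U (conj (Ψ f))` one gets `Σ* M f = U⁻¹ H̃ U (conj (Ψ f))`. This is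
`Ψ̃(M̃) M̃ Ψ(M) f`, because the spectral representation of `M̃` commutes with conjugation
(`IsSpectralDatum.isModelContraction`). As `M` has dense range, the datum determines `Σ*`; it
determines `q`, and hence every `û_k = ⟨S*^k u, 1⟩`. -/

noncomputable section

namespace HankelInverse

/-! ### Polynomial and continuous functional calculus on cyclic subspaces -/

section FunctionalCalculus

variable {E F : Type*} [NormedAddCommGroup E] [InnerProductSpace ℂ E]
  [NormedAddCommGroup F] [InnerProductSpace ℂ F]

/-- The orbit map `p ↦ p(T) v` on polynomials. -/
def orbitMap (T : E →L[ℂ] E) (v : E) : ℂ[X] →ₗ[ℂ] E where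
  toFun p := aeval T p v
  map_add' p q := by simp
  map_smul' c p := by simp

theorem orbitMap_apply (T : E →L[ℂ] E) (v : E) (p : ℂ[X]) : orbitMap T v p = aeval T p v := rfl

theorem orbitMap_monomial (T : E →L[ℂ] E) (v : E) (n : ℕ) (a : ℂ) :
    orbitMap T v (monomial n a) = a • (T ^ n) v := by
  simp [orbitMap_apply, aeval_monomial, ← Algebra.smul_def]

theorem orbitMap_one (T : E →L[ℂ] E) (v : E) : orbitMap T v 1 = v := by
  simp [orbitMap_apply]

theorem orbitMap_X_mul (T : E →L[ℂ] E) (v : E) (p : ℂ[X]) :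
    orbitMap T v (X * p) = T (orbitMap T v p) := by
  simp [orbitMap_apply]

theorem range_orbitMap (T : E →L[ℂ] E) (v : E) :
    LinearMap.range (orbitMap T v) = Submodule.span ℂ (Set.range fun n : ℕ => (T ^ n) v) := by
  apply le_antisymm
  · rintro _ ⟨p, rfl⟩
    induction p using Polynomial.induction_on' with
    | add p q hp hq => rw [map_add]; exact add_mem hp hq
    | monomial n a =>
      rw [orbitMap_monomial]
      exact Submodule.smul_mem _ _ (Submodule.subset_span ⟨n, rfl⟩)
  · rw [Submodule.span_le]
    rintro _ ⟨n, rfl⟩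
    exact ⟨monomial n 1, by simp [orbitMap_monomial]⟩

theorem cyclicSubspace_eq (T : E →L[ℂ] E) (v : E) :
    cyclicSubspace T v = (LinearMap.range (orbitMap T v)).topologicalClosure := by
  rw [range_orbitMap, cyclicSubspace]

theorem orbitMap_mem_cyclicSubspace (T : E →L[ℂ] E) (v : E) (p : ℂ[X]) :
    orbitMap T v p ∈ cyclicSubspace T v := by
  rw [cyclicSubspace_eq]
  exact Submodule.le_topologicalClosure _ ⟨p, rfl⟩

theorem self_mem_cyclicSubspace (T : E →L[ℂ] E) (v : E) : v ∈ cyclicSubspace T v := by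
  simpa [orbitMap_one] using orbitMap_mem_cyclicSubspace T v 1

/-- A closed subspace containing `v` and invariant under `T` contains the cyclic subspace. -/
theorem cyclicSubspace_le {T : E →L[ℂ] E} {v : E} {K : Submodule ℂ E} (hK : IsClosed (K : Set E))
    (hv : v ∈ K) (hT : ∀ x ∈ K, T x ∈ K) : cyclicSubspace T v ≤ K := by
  refine Submodule.topologicalClosure_minimal _ (Submodule.span_le.2 ?_) hK
  rintro _ ⟨n, rfl⟩
  change (T ^ n) v ∈ K
  induction n with
  | zero => simpa using hv
  | succ n ih => rw [pow_succ']; exact hT _ ih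

theorem map_cyclicSubspace {T : E →L[ℂ] E} {v x : E} (hx : x ∈ cyclicSubspace T v) :
    T x ∈ cyclicSubspace T v := by
  rw [cyclicSubspace_eq] at hx ⊢
  have hx' : x ∈ closure (LinearMap.range (orbitMap T v) : Set E) := hx
  refine closure_mono ?_ (image_closure_subset_closure_image T.continuous ⟨x, hx', rfl⟩)
  rintro _ ⟨_, ⟨p, rfl⟩, rfl⟩
  exact ⟨X * p, orbitMap_X_mul T v p⟩

/-- Equality on a cyclic subspace of two continuous maps can be checked on polynomials. -/
theorem eqOn_cyclicSubspace {T : E →L[ℂ] E} {v : E} {Y : Type*} [TopologicalSpace Y] [T2Space Y]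
    {f g : E → Y} (hf : Continuous f) (hg : Continuous g)
    (h : ∀ p, f (orbitMap T v p) = g (orbitMap T v p)) {x : E} (hx : x ∈ cyclicSubspace T v) :
    f x = g x := by
  rw [cyclicSubspace_eq] at hx
  have hx' : x ∈ closure (LinearMap.range (orbitMap T v) : Set E) := hx
  refine Set.EqOn.closure (s := (LinearMap.range (orbitMap T v) : Set E)) ?_ hf hg hx'
  rintro _ ⟨p, rfl⟩
  exact h p

/-- Real coefficients need only real-linearity of `U`, so unitaries and anti-linear operators are
covered at once. -/
theorem map_aeval_of_intertwine (U : E →L[ℝ] F) {A : E →L[ℂ] E} {B : F →L[ℂ] F}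
    (h : ∀ x, U (A x) = B (U x)) (p : ℝ[X]) (x : E) : U (aeval A p x) = aeval B p (U x) := by
  have hpow : ∀ n : ℕ, U ((A ^ n) x) = (B ^ n) (U x) := by
    intro n
    induction n with
    | zero => simp
    | succ n ih => rw [pow_succ', pow_succ', mul_apply_eq_comp, mul_apply_eq_comp, h, ih]
  induction p using Polynomial.induction_on' with
  | add p q hp hq => simp [hp, hq]
  | monomial n a =>
    rw [aeval_monomial, aeval_monomial, ← Algebra.smul_def, ← Algebra.smul_def, _root_.smul_apply,
      _root_.smul_apply, map_smul, hpow]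

theorem map_orbitMap_of_conj {A : E →SL[starRingEnd ℂ] E} {T : E →L[ℂ] E} (h : ∀ f, A (T f) = T (A f)) (v : E)
    (p : ℂ[X]) : A (orbitMap T v p) = orbitMap T (A v) (p.map (starRingEnd ℂ)) := by
  have hpow : ∀ n : ℕ, A ((T ^ n) v) = (T ^ n) (A v) := by
    intro n
    induction n with
    | zero => simp
    | succ n ih => rw [pow_succ', mul_apply_eq_comp, mul_apply_eq_comp, h, ih]
  induction p using Polynomial.induction_on' with
  | add p q hp hq => rw [map_add, map_add, hp, hq, Polynomial.map_add, map_add]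
  | monomial n a => rw [map_monomial, orbitMap_monomial, orbitMap_monomial, map_smulₛₗ, hpow]

theorem map_orbitMap {T : E →L[ℂ] E} {S : F →L[ℂ] F} {Q : E →L[ℂ] F}
    (h : ∀ f, Q (T f) = S (Q f)) (v : E) (p : ℂ[X]) :
    Q (orbitMap T v p) = orbitMap S (Q v) p := by
  have hpow : ∀ n : ℕ, Q ((T ^ n) v) = (S ^ n) (Q v) := by
    intro n
    induction n with
    | zero => simp
    | succ n ih => rw [pow_succ', pow_succ', mul_apply_eq_comp, mul_apply_eq_comp, h, ih]
  induction p using Polynomial.induction_on' with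
  | add p q hp hq => rw [map_add, map_add, hp, hq, map_add]
  | monomial n a => rw [orbitMap_monomial, orbitMap_monomial, map_smul, hpow]

variable [CompleteSpace E] [CompleteSpace F]

theorem inner_orbitMap_conj {T : E →L[ℂ] E} (hT : IsSelfAdjoint T) (v w : E) (p : ℂ[X]) :
    inner ℂ (orbitMap T v (p.map (starRingEnd ℂ))) w = inner ℂ v (orbitMap T w p) := by
  induction p using Polynomial.induction_on' with
  | add p q hp hq => simp only [Polynomial.map_add, map_add, inner_add_left, inner_add_right, hp, hq]
  | monomial n a =>
    have h := (hT.pow n).isSymmetric v w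
    rw [ContinuousLinearMap.coe_coe] at h
    rw [map_monomial, orbitMap_monomial, orbitMap_monomial, inner_smul_left, inner_smul_right, h,
      Complex.conj_conj]

/-- The maximum with `0` is needed when `K` is empty: the pointwise bound then says nothing about
the sign of `ε`. -/
theorem norm_cfc_sub_aeval_le {A : E →L[ℂ] E} (hA : IsSelfAdjoint A) {f : ℝ → ℝ}
    (hf : Continuous f) {p : ℝ[X]} {K : Set ℝ} {ε : ℝ} (hK : spectrum ℝ A ⊆ K)
    (hp : ∀ x ∈ K, |p.eval x - f x| ≤ ε) : ‖cfc f A - aeval A p‖ ≤ max ε 0 := by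
  rw [← cfc_polynomial p A, ← cfc_sub f (fun t => p.eval t) A hf.continuousOn]
  refine norm_cfc_le (le_max_right _ _) fun t ht => ?_
  rw [Real.norm_eq_abs, abs_sub_comm]
  exact (hp t (hK ht)).trans (le_max_left _ _)

/-- A bounded real-linear (for example: linear or anti-linear) map that intertwines two
self-adjoint operators intertwines their continuous functions. -/
theorem map_cfc_of_intertwine (U : E →L[ℝ] F) {A : E →L[ℂ] E} {B : F →L[ℂ] F}
    (hA : IsSelfAdjoint A) (hB : IsSelfAdjoint B) (h : ∀ x, U (A x) = B (U x))
    {f : ℝ → ℝ} (hf : Continuous f) (x : E) : U (cfc f A x) = cfc f B (U x) := by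
  -- One interval contains both spectra, so a single polynomial approximates `f` in both calculi.
  obtain ⟨R, hR⟩ : ∃ R, spectrum ℝ A ∪ spectrum ℝ B ⊆ Metric.closedBall 0 R :=
    (((spectrum.isCompact A).union (spectrum.isCompact B)).isBounded).subset_closedBall 0
  rw [Real.closedBall_eq_Icc] at hR
  rw [← sub_eq_zero, ← norm_le_zero_iff]
  set C := ‖U‖ * ‖x‖ + ‖U x‖ with hC
  have hC0 : 0 ≤ C := by positivity
  refine le_of_forall_pos_le_add fun ε hε => ?_
  -- The total error is at most the tolerance times `C`; the `+ 1` avoids division by zero.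
  obtain ⟨p, hp⟩ := exists_polynomial_near_of_continuousOn _ _ f hf.continuousOn (ε / (C + 1))
    (by positivity)
  have hp' : ∀ x ∈ Set.Icc (0 - R) (0 + R), |p.eval x - f x| ≤ ε / (C + 1) :=
    fun x hx => (hp x hx).le
  have h1 := norm_cfc_sub_aeval_le hA hf (Set.subset_union_left.trans hR) hp'
  have h2 := norm_cfc_sub_aeval_le hB hf (Set.subset_union_right.trans hR) hp'
  rw [max_eq_left (by positivity)] at h1 h2
  have h3 : U (cfc f A x) - cfc f B (U x)
      = U ((cfc f A - aeval A p) x) - (cfc f B - aeval B p) (U x) := by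
    simp [map_aeval_of_intertwine U h]
  rw [h3]
  calc _ ≤ ‖U‖ * (ε / (C + 1) * ‖x‖) + ε / (C + 1) * ‖U x‖ := by
        refine (norm_sub_le _ _).trans (add_le_add ?_ ?_)
        · exact (U.le_opNorm _).trans (mul_le_mul_of_nonneg_left
            (ContinuousLinearMap.le_of_opNorm_le _ h1 x) (norm_nonneg _))
        · exact ContinuousLinearMap.le_of_opNorm_le _ h2 _
    _ = ε / (C + 1) * C := by rw [hC]; ring
    _ ≤ 0 + ε := by
        rw [zero_add, div_mul_eq_mul_div, div_le_iff₀ (by positivity)]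
        nlinarith

theorem isSelfAdjoint_opSqrt (T : E →L[ℂ] E) : IsSelfAdjoint (opSqrt T) := cfc_predicate _ _

theorem opSqrt_mul_self {T : E →L[ℂ] E} (hT : 0 ≤ T) : opSqrt T * opSqrt T = T := by
  have hs : IsSelfAdjoint T := IsSelfAdjoint.of_nonneg hT
  rw [opSqrt, ← cfc_mul Real.sqrt Real.sqrt T]
  conv_rhs => rw [← cfc_id' ℝ T]
  refine cfc_congr fun x hx => ?_
  exact Real.mul_self_sqrt (spectrum_nonneg_of_nonneg hT hx)

theorem opSqrt_nonneg (T : E →L[ℂ] E) : 0 ≤ opSqrt T :=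
  cfc_nonneg fun _ _ => Real.sqrt_nonneg _

theorem norm_sq_opSqrt_apply {T : E →L[ℂ] E} (hT : 0 ≤ T) (x : E) :
    ‖opSqrt T x‖ ^ 2 = (inner ℂ x (T x)).re := by
  conv_rhs => rw [← opSqrt_mul_self hT]
  have h := (isSelfAdjoint_opSqrt T).isSymmetric x (opSqrt T x)
  rw [mul_apply_eq_comp]
  change inner ℂ (opSqrt T x) (opSqrt T x) = inner ℂ x (opSqrt T (opSqrt T x)) at h
  rw [← h, inner_self_eq_norm_sq_to_K]
  norm_cast

/-- By self-adjointness `⟨T^m v, T^n v⟩ = ⟨v, T^(m+n) v⟩`, so the moments determine the Gram matrix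
of the orbit. -/
theorem inner_orbitMap_eq_of_moments {T : E →L[ℂ] E} {S : F →L[ℂ] F} (hT : IsSelfAdjoint T)
    (hS : IsSelfAdjoint S) {v : E} {w : F}
    (h : ∀ n : ℕ, inner ℂ v ((T ^ n) v) = inner ℂ w ((S ^ n) w)) (p r : ℂ[X]) :
    inner ℂ (orbitMap T v p) (orbitMap T v r) = inner ℂ (orbitMap S w p) (orbitMap S w r) := by
  have h1 : ∀ m n : ℕ, inner ℂ ((T ^ m) v) ((T ^ n) v) = inner ℂ ((S ^ m) w) ((S ^ n) w) := by
    intro m n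
    have e1 := (hT.pow m).isSymmetric v ((T ^ n) v)
    have e2 := (hS.pow m).isSymmetric w ((S ^ n) w)
    rw [ContinuousLinearMap.coe_coe] at e1 e2
    rw [e1, e2, ← mul_apply_eq_comp, ← mul_apply_eq_comp, ← pow_add,
      ← pow_add, h]
  induction p using Polynomial.induction_on' with
  | add p q hp hq => simp only [map_add, inner_add_left, hp, hq]
  | monomial m a =>
    induction r using Polynomial.induction_on' with
    | add p q hp hq => simp only [map_add, inner_add_right, hp, hq]
    | monomial n b => simp only [orbitMap_monomial, inner_smul_left, inner_smul_right, h1]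

end FunctionalCalculus

/-! ### Unitaries onto a subspace -/

section Unitary

variable {E F : Type*} [NormedAddCommGroup E] [InnerProductSpace ℂ E]
  [NormedAddCommGroup F] [InnerProductSpace ℂ F] {X : Submodule ℂ E}

/-- A unitary onto a subspace as an isometry into the ambient space. -/
def ambientIsometry (U : F ≃ₗᵢ[ℂ] X) : F →ₗᵢ[ℂ] E := X.subtypeₗᵢ.comp U.toLinearIsometry

theorem ambientIsometry_apply (U : F ≃ₗᵢ[ℂ] X) (f : F) : ambientIsometry U f = (U f : E) := rfl

/-- A unitary onto a subspace as a real-linear map into the ambient space. -/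
def ambientReal (U : F ≃ₗᵢ[ℂ] X) : F →L[ℝ] E :=
  (ambientIsometry U).toContinuousLinearMap.restrictScalars ℝ

theorem ambientReal_apply (U : F ≃ₗᵢ[ℂ] X) (f : F) : ambientReal U f = (U f : E) := rfl

theorem inner_ambient (U : F ≃ₗᵢ[ℂ] X) (f g : F) : inner ℂ (U f : E) (U g : E) = inner ℂ f g :=
  (ambientIsometry U).inner_map_map f g

end Unitary

/-! ### Support and integrals of spectral measures -/

section SpectralMeasure

variable {E : Type*} [NormedAddCommGroup E] [InnerProductSpace ℂ E] [CompleteSpace E]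

theorem spectralFunctional_apply (T : E →L[ℂ] E) (v : E)
    (f : CompactlySupportedContinuousMap ℝ ℝ) :
    spectralFunctional T v f = (inner ℂ v (cfc (f : ℝ → ℝ) T v)).re := rfl

/-- By regularity it suffices to treat compact sets off the spectrum. A continuous function equal to
`1` on such a set and `0` on the spectrum has zero functional calculus, and it dominates the measure
of the set. -/
theorem spectralMeasure_compl_spectrum (T : E →L[ℂ] E) (v : E) :
    spectralMeasure T v (spectrum ℝ T)ᶜ = 0 := by
  have hK := spectrum.isCompact (𝕜 := ℝ) T
  have : (spectralMeasure T v).Regular := RealRMK.regular_rieszMeasure _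
  rw [hK.isClosed.isOpen_compl.measure_eq_iSup_isCompact]
  simp only [ENNReal.iSup_eq_zero]
  intro C hC hCc
  obtain ⟨f, h1, h0, hfc, hf⟩ := exists_continuous_one_zero_of_isCompact hCc hK.isClosed
    (Set.disjoint_left.2 fun x hx hx' => hC hx hx')
  have h := RealRMK.rieszMeasure_le_of_eq_one (spectralFunctional T v)
    (f := ⟨f, hfc⟩) (fun x => (hf x).1) hCc (fun x hx => h1 hx)
  have h2 : cfc (f : ℝ → ℝ) T = 0 := by
    rw [← cfc_zero ℝ T]
    exact cfc_congr fun x hx => h0 hx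
  have h3 : spectralFunctional T v ⟨f, hfc⟩ = 0 := by
    rw [spectralFunctional_apply]
    change (inner ℂ v (cfc (f : ℝ → ℝ) T v)).re = 0
    rw [h2]; simp
  rw [h3, ENNReal.ofReal_zero] at h
  exact le_antisymm h (zero_le)

instance isFiniteMeasure_spectralMeasure (T : E →L[ℂ] E) (v : E) :
    IsFiniteMeasure (spectralMeasure T v) := by
  have : (spectralMeasure T v).Regular := RealRMK.regular_rieszMeasure _
  refine ⟨?_⟩
  rw [← Set.union_compl_self (spectrum ℝ T)]
  refine (measure_union_le _ _).trans_lt ?_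
  rw [spectralMeasure_compl_spectrum, add_zero]
  exact (spectrum.isCompact T).measure_lt_top

theorem ae_mem_spectrum (T : E →L[ℂ] E) (v : E) :
    ∀ᵐ s ∂(spectralMeasure T v), s ∈ spectrum ℝ T := spectralMeasure_compl_spectrum T v

theorem integral_spectralMeasure (T : E →L[ℂ] E) (v : E) {f : ℝ → ℝ} (hf : Continuous f) :
    ∫ s, f s ∂(spectralMeasure T v) = (inner ℂ v (cfc f T v)).re := by
  -- A cutoff equal to `1` on the spectrum makes `f` compactly supported and changes neither side.
  obtain ⟨χ, h1, -, hχc, hχ⟩ := exists_continuous_one_zero_of_isCompact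
    (spectrum.isCompact (𝕜 := ℝ) T) isClosed_empty (Set.disjoint_empty _)
  let g : CompactlySupportedContinuousMap ℝ ℝ :=
    ⟨⟨fun s => χ s * f s, χ.continuous.mul hf⟩, hχc.mul_right⟩
  have hg : ∀ s, g s = χ s * f s := fun _ => rfl
  have h2 : ∫ s, f s ∂(spectralMeasure T v) = ∫ s, g s ∂(spectralMeasure T v) := by
    refine integral_congr_ae ?_
    filter_upwards [ae_mem_spectrum T v] with s hs
    rw [hg, h1 hs, Pi.one_apply, one_mul]
  rw [h2, spectralMeasure, RealRMK.integral_rieszMeasure, spectralFunctional_apply]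
  have h3 : cfc (g : ℝ → ℝ) T = cfc f T := cfc_congr fun s hs => by
    rw [hg, h1 hs, Pi.one_apply, one_mul]
  rw [h3]

theorem memLp_top_coe_spectralMeasure (T : E →L[ℂ] E) (v : E) :
    MemLp (fun s : ℝ => (s : ℂ)) ∞ (spectralMeasure T v) := by
  obtain ⟨R, hR⟩ := (spectrum.isCompact (𝕜 := ℝ) T).isBounded.exists_norm_le
  refine memLp_top_of_bound (by fun_prop) R ?_
  filter_upwards [ae_mem_spectrum T v] with s hs
  simpa using hR s hs

end SpectralMeasure

/-! ### Multiplication by `s` in `L²(ρ)` and density of polynomials -/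

section Model

variable {ρ : Measure ℝ}

theorem coeFn_opM (hρ : MemLp (fun s : ℝ => (s : ℂ)) ∞ ρ) (f : Lp ℂ 2 ρ) :
    opM ρ f =ᵐ[ρ] fun s => (s : ℂ) * f s := by
  rw [opM, dif_pos hρ]
  filter_upwards [coeFn_mulOp hρ.toLp f, hρ.coeFn_toLp] with s h1 h2
  rw [h1, h2]

theorem isSelfAdjoint_opM (hρ : MemLp (fun s : ℝ => (s : ℂ)) ∞ ρ) : IsSelfAdjoint (opM ρ) := by
  rw [ContinuousLinearMap.isSelfAdjoint_iff_isSymmetric]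
  intro f g
  rw [ContinuousLinearMap.coe_coe, L2.inner_def, L2.inner_def]
  refine integral_congr_ae ?_
  filter_upwards [coeFn_opM hρ f, coeFn_opM hρ g] with s h1 h2
  rw [h1, h2]
  simp only [RCLike.inner_apply, map_mul, Complex.conj_ofReal]
  ring

theorem coeFn_orbitMap_opM_apply (hρ : MemLp (fun s : ℝ => (s : ℂ)) ∞ ρ) (f : Lp ℂ 2 ρ)
    (p : ℂ[X]) : orbitMap (opM ρ) f p =ᵐ[ρ] fun s => p.eval (s : ℂ) * f s := by
  have hpow : ∀ n : ℕ, ((opM ρ ^ n) f : Lp ℂ 2 ρ) =ᵐ[ρ] fun s => (s : ℂ) ^ n * f s := by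
    intro n
    induction n with
    | zero => simp
    | succ n ih =>
      rw [pow_succ', mul_apply_eq_comp]
      filter_upwards [ih, coeFn_opM hρ ((opM ρ ^ n) f)] with s h1 h2
      rw [h2, h1, pow_succ', mul_assoc]
  induction p using Polynomial.induction_on' with
  | add p q hp hq =>
    rw [map_add]
    filter_upwards [hp, hq, Lp.coeFn_add (orbitMap (opM ρ) f p) (orbitMap (opM ρ) f q)]
      with s h1 h2 h3
    rw [h3, Pi.add_apply, h1, h2, eval_add, add_mul]
  | monomial n a =>
    rw [orbitMap_monomial]
    filter_upwards [hpow n, Lp.coeFn_smul a ((opM ρ ^ n) f)] with s h1 h2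
    rw [h2, Pi.smul_apply, h1, eval_monomial, smul_eq_mul, mul_assoc]

variable [IsFiniteMeasure ρ]

theorem coeFn_oneL2 : oneL2 ρ =ᵐ[ρ] fun _ => (1 : ℂ) := Lp.coeFn_const ..

theorem coeFn_orbitMap_opM (hρ : MemLp (fun s : ℝ => (s : ℂ)) ∞ ρ) (p : ℂ[X]) :
    orbitMap (opM ρ) (oneL2 ρ) p =ᵐ[ρ] fun s => p.eval (s : ℂ) := by
  filter_upwards [coeFn_orbitMap_opM_apply hρ (oneL2 ρ) p, coeFn_oneL2 (ρ := ρ)] with s h1 h2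
  rw [h1, h2, mul_one]

/-- The `L²` class of `p` is the orbit vector `p(M) 𝟙`, so the almost-everywhere condition becomes
an algebraic one. -/
theorem isSpectralUnitary_iff (hρ : MemLp (fun s : ℝ => (s : ℂ)) ∞ ρ)
    {E : Type*} [NormedAddCommGroup E] [InnerProductSpace ℂ E] {T : E →L[ℂ] E} {v : E}
    {X : Submodule ℂ E} {U : Lp ℂ 2 ρ ≃ₗᵢ[ℂ] X} :
    IsSpectralUnitary T v U ↔
      ∀ p, (U (orbitMap (opM ρ) (oneL2 ρ) p) : E) = orbitMap T v p := by
  constructor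
  · intro h p
    exact h p _ (coeFn_orbitMap_opM hρ p)
  · intro h p f hf
    rw [← orbitMap_apply, ← h, Lp.ext (hf.trans (coeFn_orbitMap_opM hρ p).symm)]

/-- Polynomials are dense in `L²(ρ)` for a finite measure `ρ` with bounded support. -/
theorem denseRange_orbitMap_opM (hρ : MemLp (fun s : ℝ => (s : ℂ)) ∞ ρ) :
    DenseRange (orbitMap (opM ρ) (oneL2 ρ)) := by
  obtain ⟨R, hR⟩ : ∃ R : ℝ, ∀ᵐ s ∂ρ, |s| ≤ R := by
    refine ⟨(eLpNorm (fun s : ℝ => (s : ℂ)) ∞ ρ).toReal, ?_⟩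
    filter_upwards [ae_le_eLpNormEssSup (f := fun s : ℝ => (s : ℂ)) (μ := ρ)] with s hs
    rw [← eLpNorm_exponent_top] at hs
    have := ENNReal.toReal_mono hρ.eLpNorm_ne_top hs
    simpa using this
  intro f
  rw [Metric.mem_closure_iff]
  intro ε hε
  obtain ⟨g, -, hg, hgc, hgL⟩ := (Lp.memLp f).exists_hasCompactSupport_eLpNorm_sub_le
    ENNReal.ofNat_ne_top (ε := ENNReal.ofReal (ε / 2)) (by simpa using hε)
  -- `m = ρ(ℝ)^(1/2)` bounds the `L²` norm by the sup norm. The real and imaginary parts each cost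
  -- `δ`, and `δ` is chosen so that `m * (2 * δ) ≤ ε / 4`.
  set m : ℝ := (measureUnivNNReal ρ : ℝ) ^ (2 : ℝ≥0∞).toReal⁻¹ with hm
  have hm0 : 0 ≤ m := by positivity
  set δ : ℝ := ε / (8 * (m + 1)) with hδ
  have hδ0 : 0 < δ := by positivity
  obtain ⟨p, hp⟩ := exists_polynomial_near_of_continuousOn (-R) R (fun s => (g s).re)
    (Complex.continuous_re.comp hgc).continuousOn δ hδ0
  obtain ⟨q, hq⟩ := exists_polynomial_near_of_continuousOn (-R) R (fun s => (g s).im)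
    (Complex.continuous_im.comp hgc).continuousOn δ hδ0
  let P : ℂ[X] := p.map Complex.ofRealHom + C Complex.I * q.map Complex.ofRealHom
  have hP : ∀ s : ℝ, P.eval (s : ℂ) = ((p.eval s : ℝ) : ℂ) + Complex.I * ((q.eval s : ℝ) : ℂ) := by
    intro s
    have h : ∀ r : ℝ[X], (r.map Complex.ofRealHom).eval (s : ℂ) = ((r.eval s : ℝ) : ℂ) :=
      fun r => by rw [eval_map, ← Complex.ofRealHom_eq_coe, eval₂_at_apply]; rfl
    simp [P, h]
  refine ⟨_, ⟨P, rfl⟩, ?_⟩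
  rw [dist_eq_norm]
  have h1 : ‖f - hgL.toLp g‖ ≤ ε / 2 := by
    rw [Lp.norm_def]
    refine ENNReal.toReal_le_of_le_ofReal (by positivity) ?_
    rwa [eLpNorm_congr_ae]
    filter_upwards [Lp.coeFn_sub f (hgL.toLp g), hgL.coeFn_toLp] with s h1 h2
    rw [h1, Pi.sub_apply, h2, Pi.sub_apply]
  have h2 : ‖hgL.toLp g - orbitMap (opM ρ) (oneL2 ρ) P‖ ≤ m * (2 * δ) := by
    refine Lp.norm_le_of_ae_bound (by positivity) ?_
    filter_upwards [Lp.coeFn_sub (hgL.toLp g) (orbitMap (opM ρ) (oneL2 ρ) P), hgL.coeFn_toLp,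
      coeFn_orbitMap_opM hρ P, hR] with s h1 h2 h3 h4
    rw [h1, Pi.sub_apply, h2, h3, hP, norm_sub_rev]
    have e : ((p.eval s : ℝ) : ℂ) + Complex.I * ((q.eval s : ℝ) : ℂ) - g s
        = ((p.eval s - (g s).re : ℝ) : ℂ) + Complex.I * ((q.eval s - (g s).im : ℝ) : ℂ) := by
      conv_lhs => rw [← Complex.re_add_im (g s)]
      push_cast
      ring
    rw [e]
    refine (norm_add_le _ _).trans ?_
    rw [norm_mul, Complex.norm_I, one_mul, Complex.norm_real, Complex.norm_real, two_mul]
    exact add_le_add (hp s (abs_le.1 h4)).le (hq s (abs_le.1 h4)).le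
  calc _ = ‖(f - hgL.toLp g) + (hgL.toLp g - orbitMap (opM ρ) (oneL2 ρ) P)‖ := by
        congr 1; abel
    _ ≤ ε / 2 + m * (2 * δ) := (norm_add_le _ _).trans (add_le_add h1 h2)
    _ < ε := by
        have : m * (2 * δ) ≤ ε / 4 := by
          rw [hδ]
          rw [show m * (2 * (ε / (8 * (m + 1)))) = (ε / 4) * (m / (m + 1)) by field_simp; ring]
          exact mul_le_of_le_one_right (by positivity) ((div_le_one (by positivity)).2 (by linarith))
        linarith

/-- Two continuous maps on `L²(ρ)` that agree on polynomials are equal. -/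
theorem eq_of_eq_on_polynomials (hρ : MemLp (fun s : ℝ => (s : ℂ)) ∞ ρ) {Y : Type*}
    [TopologicalSpace Y] [T2Space Y] {f g : Lp ℂ 2 ρ → Y} (hf : Continuous f) (hg : Continuous g)
    (h : ∀ p, f (orbitMap (opM ρ) (oneL2 ρ) p) = g (orbitMap (opM ρ) (oneL2 ρ) p)) : f = g :=
  (denseRange_orbitMap_opM hρ).equalizer hf hg (funext h)

/-- A continuous map on `L²(ρ)` that acts on polynomials as `p ↦ φ p̄` does so everywhere. -/
theorem ae_eq_mul_conj (hρ : MemLp (fun s : ℝ => (s : ℂ)) ∞ ρ) {K : Lp ℂ 2 ρ → Lp ℂ 2 ρ}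
    (hK : Continuous K) {φ : ℝ → ℂ}
    (h : ∀ p : ℂ[X], K (orbitMap (opM ρ) (oneL2 ρ) p) =ᵐ[ρ]
      fun s => φ s * conj (p.eval (s : ℂ))) (f : Lp ℂ 2 ρ) :
    K f =ᵐ[ρ] fun s => φ s * conj (f s) := by
  -- Nothing bounds `φ`, so the right-hand side is not known to be `L²`-continuous in `f`. Two
  -- successive subsequences give almost-everywhere convergence of both the polynomials and their
  -- images.
  obtain ⟨x, hx, hxf⟩ := mem_closure_iff_seq_limit.1 (denseRange_orbitMap_opM hρ f)
  choose p hp using hx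
  obtain ⟨ns, hns, h1⟩ := (tendstoInMeasure_of_tendsto_Lp hxf).exists_seq_tendsto_ae
  have h2 : Tendsto (fun n => K (x (ns n))) atTop (𝓝 (K f)) :=
    (hK.tendsto f).comp (hxf.comp hns.tendsto_atTop)
  obtain ⟨ms, hms, h3⟩ := (tendstoInMeasure_of_tendsto_Lp h2).exists_seq_tendsto_ae
  have h4 : ∀ᵐ s ∂ρ, ∀ n, K (x n) s = φ s * conj (x n s) := by
    rw [ae_all_iff]
    intro n
    rw [← hp]
    filter_upwards [h (p n), coeFn_orbitMap_opM hρ (p n)] with s h5 h6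
    rw [h5, h6]
  filter_upwards [h1, h3, h4] with s h1 h3 h4
  refine tendsto_nhds_unique h3 ?_
  simp only [h4]
  exact ((Complex.continuous_conj.tendsto _).comp (h1.comp hms.tendsto_atTop)).const_mul _

end Model

/-! ### Spectral representation on a cyclic subspace -/

section SpectralUnitary

variable {E : Type*} [NormedAddCommGroup E] [InnerProductSpace ℂ E]
  {ρ : Measure ℝ} [IsFiniteMeasure ρ] {T : E →L[ℂ] E} {v : E} {X : Submodule ℂ E}

theorem IsSpectralUnitary.map_one (hρ : MemLp (fun s : ℝ => (s : ℂ)) ∞ ρ)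
    {U : Lp ℂ 2 ρ ≃ₗᵢ[ℂ] X} (hU : IsSpectralUnitary T v U) : (U (oneL2 ρ) : E) = v := by
  simpa [orbitMap_one] using (isSpectralUnitary_iff hρ).1 hU 1

theorem IsSpectralUnitary.map_opM (hρ : MemLp (fun s : ℝ => (s : ℂ)) ∞ ρ)
    {U : Lp ℂ 2 ρ ≃ₗᵢ[ℂ] X} (hU : IsSpectralUnitary T v U) (f : Lp ℂ 2 ρ) :
    (U (opM ρ f) : E) = T (U f) := by
  have h : (fun f : Lp ℂ 2 ρ => (U (opM ρ f) : E)) = fun f => T (U f) := by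
    refine eq_of_eq_on_polynomials hρ (by fun_prop) (by fun_prop) fun p => ?_
    rw [← orbitMap_X_mul, (isSpectralUnitary_iff hρ).1 hU, (isSpectralUnitary_iff hρ).1 hU,
      orbitMap_X_mul]
  exact congrFun h f

theorem IsSpectralUnitary.unique (hρ : MemLp (fun s : ℝ => (s : ℂ)) ∞ ρ)
    {U V : Lp ℂ 2 ρ ≃ₗᵢ[ℂ] X} (hU : IsSpectralUnitary T v U) (hV : IsSpectralUnitary T v V) :
    U = V := by
  have h : (U : Lp ℂ 2 ρ → X) = V := by
    refine eq_of_eq_on_polynomials hρ U.continuous V.continuous fun p => Subtype.ext ?_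
    rw [(isSpectralUnitary_iff hρ).1 hU, (isSpectralUnitary_iff hρ).1 hV]
  exact LinearIsometryEquiv.ext (congrFun h)

variable [CompleteSpace E]

theorem inner_orbitMap_spectralMeasure (hT : IsSelfAdjoint T) (v : E) (p r : ℂ[X]) :
    inner ℂ (orbitMap T v p) (orbitMap T v r)
      = inner ℂ (orbitMap (opM (spectralMeasure T v)) (oneL2 (spectralMeasure T v)) p)
        (orbitMap (opM (spectralMeasure T v)) (oneL2 (spectralMeasure T v)) r) := by
  have hρ := memLp_top_coe_spectralMeasure T v
  refine inner_orbitMap_eq_of_moments hT (isSelfAdjoint_opM hρ) (fun n => ?_) p r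
  -- The spectral measure records only real parts; self-adjointness makes the moments real.
  have h1 : inner ℂ v ((T ^ n) v) = ((inner ℂ v ((T ^ n) v)).re : ℂ) := by
    have h := (hT.pow n).isSymmetric v v
    rw [ContinuousLinearMap.coe_coe] at h
    exact (Complex.conj_eq_iff_real.1 ((inner_conj_symm _ _).trans h)).elim
      fun r hr => by rw [hr, Complex.ofReal_re]
  have h2 : (T ^ n) = cfc (fun s : ℝ => s ^ n) T := by rw [cfc_pow_id T n]
  rw [h1]
  conv_lhs => rw [h2, ← integral_spectralMeasure T v (by fun_prop), ← integral_complex_ofReal]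
  rw [L2.inner_def]
  refine integral_congr_ae ?_
  have h5 := coeFn_orbitMap_opM hρ (monomial n 1)
  rw [orbitMap_monomial, one_smul] at h5
  filter_upwards [coeFn_oneL2 (ρ := spectralMeasure T v), h5] with s h3 h4
  rw [h3, h4]
  simp

/-- The maps sending `p` to its class in `L²(ρ)` and to `p(T) v` have equal norms and dense ranges,
so the correspondence between their values extends to a unitary. -/
theorem exists_isSpectralUnitary (hT : IsSelfAdjoint T) (hX : cyclicSubspace T v = X) :
    ∃ U : Lp ℂ 2 (spectralMeasure T v) ≃ₗᵢ[ℂ] X, IsSpectralUnitary T v U := by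
  have hρ := memLp_top_coe_spectralMeasure T v
  have hXc : IsClosed (X : Set E) := by
    rw [← hX]; exact Submodule.isClosed_topologicalClosure _
  have : CompleteSpace X := hXc.completeSpace_coe
  let e : ℂ[X] →ₗ[ℂ] X := (orbitMap T v).codRestrict X fun p => by
    rw [← hX]; exact orbitMap_mem_cyclicSubspace T v p
  have he : DenseRange e := by
    intro x
    rw [closure_subtype]
    have hx : (x : E) ∈ cyclicSubspace T v := by rw [hX]; exact x.2
    rw [cyclicSubspace_eq] at hx
    have hx' : (x : E) ∈ closure (LinearMap.range (orbitMap T v) : Set E) := hx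
    convert hx' using 2
    ext y
    constructor
    · rintro ⟨_, ⟨p, rfl⟩, rfl⟩; exact ⟨p, rfl⟩
    · rintro ⟨p, rfl⟩; exact ⟨e p, ⟨p, rfl⟩, rfl⟩
  have hn : ∀ p, ‖e (LinearEquiv.refl ℂ ℂ[X] p)‖
      = ‖orbitMap (opM (spectralMeasure T v)) (oneL2 (spectralMeasure T v)) p‖ := by
    intro p
    have h := inner_orbitMap_spectralMeasure hT v p p
    rw [inner_self_eq_norm_sq_to_K, inner_self_eq_norm_sq_to_K] at h
    exact (sq_eq_sq₀ (norm_nonneg _) (norm_nonneg _)).1 (by exact_mod_cast h)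
  refine ⟨(LinearEquiv.refl ℂ ℂ[X]).extendOfIsometry _ e (denseRange_orbitMap_opM hρ) he hn,
    (isSpectralUnitary_iff hρ).2 fun p => ?_⟩
  rw [LinearEquiv.extendOfIsometry_eq]
  rfl

end SpectralUnitary

/-! ### The Hardy space, the shift and Taylor coefficients -/

section HardySpace

/-- The inner product of `H²` as a Hilbert space (found before the one from `CStarModule`). -/
instance innerH2 : Inner ℂ H2 := InnerProductSpace.toInner

theorem coeFn_mulZ (f : L2T) : mulZ f =ᵐ[mT] fun t => fourier 1 t * f t := by
  filter_upwards [coeFn_mulOp (fourierLp ∞ 1) f, coeFn_fourierLp (T := 1) ∞ 1] with t h1 h2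
  rw [mulZ, h1, h2]

theorem coe_shift (f : H2) : (shift f : L2T) = mulZ (f : L2T) := rfl

theorem hatCoeff_eq_inner (f : H2) (k : ℕ) :
    hatCoeff f k = inner ℂ (fourierLp 2 (k : ℤ) : L2T) (f : L2T) := by
  rw [hatCoeff, ← fourierBasis_repr, HilbertBasis.repr_apply_apply, coe_fourierBasis]

/-- The constant function `1` as an element of `H²`. -/
def oneH2 : H2 := ⟨fourierLp 2 0, fun n hn => by
  rw [← fourierBasis_repr, HilbertBasis.repr_apply_apply, coe_fourierBasis]
  exact orthonormal_fourier.inner_eq_zero hn.ne⟩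

theorem coe_shift_pow_oneH2 (k : ℕ) : ((shift ^ k) oneH2 : L2T) = fourierLp 2 (k : ℤ) := by
  induction k with
  | zero => rfl
  | succ k ih =>
    rw [pow_succ', mul_apply_eq_comp, coe_shift, ih]
    refine Lp.ext ?_
    filter_upwards [coeFn_mulZ (fourierLp 2 (k : ℤ)), coeFn_fourierLp (T := 1) 2 (k : ℤ),
      coeFn_fourierLp (T := 1) 2 ((k + 1 : ℕ) : ℤ)] with t h1 h2 h3
    rw [h1, h2, h3, ← fourier_add]
    congr 2
    push_cast
    ring

theorem hatCoeff_eq (f : H2) (k : ℕ) : hatCoeff f k = inner ℂ ((shift ^ k) oneH2) f := by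
  rw [hatCoeff_eq_inner, ← coe_shift_pow_oneH2, Submodule.coe_inner]

theorem hatCoeff_injective {f g : H2} (h : ∀ k, hatCoeff f k = hatCoeff g k) : f = g := by
  refine Subtype.ext (fourierBasis.repr.injective (lp.ext (funext fun n => ?_)))
  rw [fourierBasis_repr, fourierBasis_repr]
  rcases lt_or_ge n 0 with hn | hn
  · rw [f.2 n hn, g.2 n hn]
  · lift n to ℕ using hn
    exact h n

theorem ext_shift_pow {f g : H2}
    (h : ∀ k : ℕ, inner ℂ ((shift ^ k) oneH2) f = inner ℂ ((shift ^ k) oneH2) g) : f = g :=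
  hatCoeff_injective fun k => by rw [hatCoeff_eq, hatCoeff_eq, h]

theorem cyclicSubspace_shift : cyclicSubspace shift oneH2 = ⊤ := by
  rw [cyclicSubspace, Submodule.topologicalClosure_eq_top_iff, Submodule.eq_bot_iff]
  intro f hf
  refine ext_shift_pow fun k => ?_
  rw [inner_zero_right]
  exact (Submodule.mem_orthogonal _ _).1 hf _ (Submodule.subset_span ⟨k, rfl⟩)

theorem eq_of_eq_on_analytic_polynomials {Y : Type*} [TopologicalSpace Y] [T2Space Y]
    {f g : H2 → Y} (hf : Continuous f) (hg : Continuous g)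
    (h : ∀ p, f (orbitMap shift oneH2 p) = g (orbitMap shift oneH2 p)) : f = g :=
  funext fun x => eqOn_cyclicSubspace hf hg h (by rw [cyclicSubspace_shift]; trivial)

theorem coeFn_orbitMap_shift (p : ℂ[X]) :
    (orbitMap shift oneH2 p : L2T) =ᵐ[mT] fun t => p.eval (fourier 1 t) := by
  induction p using Polynomial.induction_on' with
  | add p q hp hq =>
    rw [map_add, Submodule.coe_add]
    filter_upwards [hp, hq, Lp.coeFn_add (orbitMap shift oneH2 p : L2T)
      (orbitMap shift oneH2 q : L2T)] with t h1 h2 h3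
    rw [h3, Pi.add_apply, h1, h2, eval_add]
  | monomial n a =>
    rw [orbitMap_monomial, Submodule.coe_smul, coe_shift_pow_oneH2]
    filter_upwards [coeFn_fourierLp (T := 1) 2 (n : ℤ), Lp.coeFn_smul a
      (fourierLp 2 (n : ℤ) : L2T)] with t h1 h2
    rw [h2, Pi.smul_apply, h1, eval_monomial, smul_eq_mul]
    congr 1
    rw [fourier_apply, fourier_apply, one_zsmul, natCast_zsmul, AddCircle.toCircle_nsmul]
    simp

theorem norm_shift (f : H2) : ‖shift f‖ = ‖f‖ := by
  rw [Submodule.coe_norm, Submodule.coe_norm, coe_shift]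
  simp only [Lp.norm_def]
  congr 1
  refine eLpNorm_congr_norm_ae ?_
  filter_upwards [coeFn_mulZ f] with t ht
  rw [ht, norm_mul, fourier_apply, Circle.norm_coe, one_mul]

theorem inner_backShift_left (f g : H2) : inner ℂ (backShift f) g = inner ℂ f (shift g) :=
  ContinuousLinearMap.adjoint_inner_left _ _ _

theorem inner_backShift_right (f g : H2) : inner ℂ f (backShift g) = inner ℂ (shift f) g :=
  ContinuousLinearMap.adjoint_inner_right _ _ _

theorem inner_shift_shift (f g : H2) : inner ℂ (shift f) (shift g) = inner ℂ f g :=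
  LinearIsometry.inner_map_map ⟨(shift : H2 →ₗ[ℂ] H2), norm_shift⟩ f g

theorem norm_backShift_le (f : H2) : ‖backShift f‖ ≤ ‖f‖ := by
  have h : ‖backShift‖ ≤ 1 := by
    rw [backShift, LinearIsometryEquiv.norm_map]
    exact ContinuousLinearMap.opNorm_le_bound _ zero_le_one fun f => by rw [norm_shift, one_mul]
  simpa using ContinuousLinearMap.le_of_opNorm_le _ h f

theorem inner_oneH2_shift (f : H2) : inner ℂ oneH2 (shift f) = 0 := by
  have h := hatCoeff_eq (shift f) 0
  rw [pow_zero, one_apply_eq_self] at h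
  rw [← h, hatCoeff, coe_shift, fourierCoeff_mulZ]
  exact f.2 _ (by norm_num)

theorem inner_shift_pow_oneH2 (f : H2) (k : ℕ) :
    inner ℂ ((shift ^ k) oneH2) f = inner ℂ oneH2 ((backShift ^ k) f) := by
  induction k generalizing f with
  | zero => simp
  | succ k ih =>
    rw [pow_succ', mul_apply_eq_comp, ← inner_backShift_right, ih, pow_succ, mul_apply_eq_comp]

theorem hatCoeff_eq_backShift (f : H2) (k : ℕ) :
    hatCoeff f k = inner ℂ oneH2 ((backShift ^ k) f) := by
  rw [hatCoeff_eq, inner_shift_pow_oneH2]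

/-- Compared coefficientwise. This rank-one defect is what separates the square of `H̃_u` from that
of `H_u`. -/
theorem shift_backShift (f : H2) : shift (backShift f) = f - inner ℂ oneH2 f • oneH2 := by
  have h1 : inner ℂ oneH2 oneH2 = (1 : ℂ) := by
    rw [Submodule.coe_inner]
    exact inner_self_eq_one_of_norm_eq_one (orthonormal_fourier.norm_eq_one 0)
  refine ext_shift_pow fun k => ?_
  have h2 (g : H2) : inner ℂ g (inner ℂ oneH2 f • oneH2) = inner ℂ oneH2 f * inner ℂ g oneH2 :=
    inner_smul_right (𝕜 := ℂ) (E := H2) g oneH2 (inner ℂ oneH2 f)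
  rw [inner_sub_right, h2]
  cases k with
  | zero => rw [pow_zero, one_apply_eq_self, inner_oneH2_shift, h1]; ring
  | succ k =>
    rw [pow_succ', mul_apply_eq_comp, inner_shift_shift, inner_backShift_right,
      ← inner_conj_symm _ oneH2, inner_oneH2_shift]
    simp

end HardySpace

/-! ### Algebra of Hankel operators -/

section Hankel

variable {u : H2} {H : H2 →SL[starRingEnd ℂ] H2}

/-- The projection disappears when paired with an analytic polynomial. The result depends only on `p
* r`; this Hankel structure yields uniqueness, symmetry and the commutation with the shift. -/
theorem IsHankel.inner_orbitMap (hH : IsHankel u H) (p r : ℂ[X]) :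
    inner ℂ (H (orbitMap shift oneH2 p)) (orbitMap shift oneH2 r)
      = ∫ t, conj ((u : L2T) t) * (p * r).eval (fourier 1 t) ∂mT := by
  have hc : Continuous fun t : Circ => p.eval (fourier 1 t) := by fun_prop
  -- A polynomial is bounded on the circle, so `u p̄` is in `L²` and can serve as `g` in `IsHankel`.
  obtain ⟨C, hC⟩ := isCompact_univ.exists_bound_of_continuousOn hc.continuousOn
  have hg : MemLp (fun t => (u : L2T) t * conj ((orbitMap shift oneH2 p : L2T) t)) 2 mT := by
    refine (Lp.memLp (u : L2T)).of_le_mul (c := C)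
      ((Lp.aestronglyMeasurable _).mul
        (Complex.continuous_conj.comp_aestronglyMeasurable (Lp.aestronglyMeasurable _))) ?_
    filter_upwards [coeFn_orbitMap_shift p] with t ht
    rw [norm_mul, RCLike.norm_conj, mul_comm, ht]
    exact mul_le_mul_of_nonneg_right (hC t trivial) (norm_nonneg _)
  rw [hH p _ hg.toLp (coeFn_orbitMap_shift p) hg.coeFn_toLp,
    Submodule.inner_orthogonalProjectionOnto_eq_of_mem_right, L2.inner_def]
  refine integral_congr_ae ?_
  filter_upwards [hg.coeFn_toLp, coeFn_orbitMap_shift p, coeFn_orbitMap_shift r] with t h1 h2 h3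
  rw [h1, h2, h3, RCLike.inner_apply, eval_mul, map_mul, Complex.conj_conj]
  ring

theorem inner_orbitMap_shift (u : H2) (r : ℂ[X]) :
    inner ℂ u (orbitMap shift oneH2 r)
      = ∫ t, conj ((u : L2T) t) * r.eval (fourier 1 t) ∂mT := by
  rw [Submodule.coe_inner, L2.inner_def]
  refine integral_congr_ae ?_
  filter_upwards [coeFn_orbitMap_shift r] with t h3
  rw [h3, RCLike.inner_apply]
  ring

theorem eq_of_inner_orbitMap_shift {f g : H2}
    (h : ∀ r, inner ℂ f (orbitMap shift oneH2 r) = inner ℂ g (orbitMap shift oneH2 r)) :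
    f = g :=
  ext_inner_right ℂ fun x => congrFun (eq_of_eq_on_analytic_polynomials
    (f := fun x => inner ℂ f x) (g := fun x => inner ℂ g x) (by fun_prop) (by fun_prop) h) x

theorem IsHankel.unique {H' : H2 →SL[starRingEnd ℂ] H2} (hH : IsHankel u H)
    (hH' : IsHankel u H') : H = H' := by
  refine ContinuousLinearMap.ext fun f => ?_
  refine congrFun (eq_of_eq_on_analytic_polynomials H.continuous H'.continuous fun p => ?_) f
  exact eq_of_inner_orbitMap_shift fun r => by rw [hH.inner_orbitMap, hH'.inner_orbitMap]

theorem IsHankel.map_one (hH : IsHankel u H) : H oneH2 = u := by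
  refine eq_of_inner_orbitMap_shift fun r => ?_
  have := hH.inner_orbitMap 1 r
  rw [orbitMap_one, one_mul] at this
  rw [this, inner_orbitMap_shift]

theorem IsHankel.map_shift (hH : IsHankel u H) (f : H2) : H (shift f) = backShift (H f) := by
  refine congrFun (eq_of_eq_on_analytic_polynomials (f := fun f => H (shift f))
    (g := fun f => backShift (H f)) (by fun_prop) (by fun_prop) fun p => ?_) f
  refine eq_of_inner_orbitMap_shift fun r => ?_
  rw [inner_backShift_left, ← orbitMap_X_mul, ← orbitMap_X_mul, hH.inner_orbitMap,
    hH.inner_orbitMap]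
  congr! 4
  ring

/-- Symmetry of an anti-linear operator. -/
def IsConjSymmetric (A : H2 →SL[starRingEnd ℂ] H2) : Prop :=
  ∀ f g, inner ℂ (A f) g = inner ℂ (A g) f

theorem IsHankel.isConjSymmetric (hH : IsHankel u H) : IsConjSymmetric H := by
  intro f g
  refine congrFun (eq_of_eq_on_analytic_polynomials (f := fun f => inner ℂ (H f) g)
    (g := fun f => inner ℂ (H g) f) (by fun_prop) (by fun_prop) fun p => ?_) f
  refine congrFun (eq_of_eq_on_analytic_polynomials
    (f := fun g => inner ℂ (H (orbitMap shift oneH2 p)) g)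
    (g := fun g => inner ℂ (H g) (orbitMap shift oneH2 p)) (by fun_prop) (by fun_prop)
    fun r => ?_) g
  rw [hH.inner_orbitMap, hH.inner_orbitMap, mul_comm p r]

theorem truncated_apply (H : H2 →SL[starRingEnd ℂ] H2) (f : H2) :
    truncated H f = H (shift f) := rfl

theorem sqOp_apply (A : H2 →SL[starRingEnd ℂ] H2) (f : H2) : sqOp A f = A (A f) := rfl

theorem IsHankel.isConjSymmetric_truncated (hH : IsHankel u H) :
    IsConjSymmetric (truncated H) := by
  intro f g
  rw [truncated_apply, truncated_apply, hH.isConjSymmetric, hH.map_shift, inner_backShift_left]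

/-- `H S H S = H (S S*) H`, and `S S*` removes the constant term. Anti-linearity and symmetry turn
the conjugate of `⟨1, H f⟩` into `⟨u, f⟩` (in the convention of `inner`). -/
theorem IsHankel.sqOp_truncated (hH : IsHankel u H) (f : H2) :
    sqOp (truncated H) f = sqOp H f - inner ℂ u f • u := by
  rw [sqOp_apply, sqOp_apply, truncated_apply, truncated_apply, hH.map_shift f, shift_backShift,
    map_sub, map_smulₛₗ, hH.map_one, inner_conj_symm, hH.isConjSymmetric f oneH2, hH.map_one]

end Hankel

/-! ### Symmetric anti-linear operators and their moduli -/

section ConjSymmetric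

variable {A : H2 →SL[starRingEnd ℂ] H2}

theorem IsConjSymmetric.sqOp_nonneg (hA : IsConjSymmetric A) : 0 ≤ sqOp A := by
  rw [ContinuousLinearMap.nonneg_iff_isPositive]
  have key : ∀ f g, inner ℂ (sqOp A f) g = inner ℂ (A g) (A f) := fun f g => hA (A f) g
  refine ⟨fun f g => ?_, fun f => ?_⟩
  · rw [ContinuousLinearMap.coe_coe, key, ← inner_conj_symm f, key, inner_conj_symm]
  · rw [ContinuousLinearMap.reApplyInnerSelf_apply, key]
    exact inner_self_nonneg

theorem IsConjSymmetric.isSelfAdjoint_sqOp (hA : IsConjSymmetric A) : IsSelfAdjoint (sqOp A) :=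
  IsSelfAdjoint.of_nonneg hA.sqOp_nonneg

theorem IsConjSymmetric.norm_modulus (hA : IsConjSymmetric A) (f : H2) :
    ‖modulus A f‖ = ‖A f‖ := by
  have h := norm_sq_opSqrt_apply hA.sqOp_nonneg f
  have h2 : inner ℂ f (sqOp A f) = (‖A f‖ : ℂ) ^ 2 := by
    rw [← inner_conj_symm, sqOp_apply, hA (A f) f, inner_conj_symm]
    exact inner_self_eq_norm_sq_to_K _
  refine (sq_eq_sq₀ (norm_nonneg _) (norm_nonneg _)).1 (h.trans ((congrArg _ h2).trans ?_))
  norm_cast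

/-- An anti-linear operator as a real-linear one. -/
def toRealLinear (A : H2 →SL[starRingEnd ℂ] H2) : H2 →L[ℝ] H2 where
  toFun := A
  map_add' := A.map_add
  map_smul' r f := by
    rw [RCLike.real_smul_eq_coe_smul (K := ℂ), RCLike.real_smul_eq_coe_smul (K := ℂ), map_smulₛₗ]
    simp
  cont := A.continuous

/-- `A` commutes with `A²`, hence with its real continuous functions. -/
theorem IsConjSymmetric.map_modulus (hA : IsConjSymmetric A) (f : H2) :
    A (modulus A f) = modulus A (A f) :=
  map_cfc_of_intertwine (toRealLinear A) hA.isSelfAdjoint_sqOp hA.isSelfAdjoint_sqOp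
    (fun _ => rfl) Real.continuous_sqrt f

theorem isClosed_ranClosure (A : H2 →SL[starRingEnd ℂ] H2) :
    IsClosed (ranClosure A : Set H2) := Submodule.isClosed_topologicalClosure _

instance (A : H2 →SL[starRingEnd ℂ] H2) : CompleteSpace (ranClosure A) :=
  (isClosed_ranClosure A).completeSpace_coe

theorem apply_mem_ranClosure (A : H2 →SL[starRingEnd ℂ] H2) (f : H2) : A f ∈ ranClosure A :=
  Submodule.le_topologicalClosure _ ⟨f, rfl⟩

theorem IsConjSymmetric.mem_orthogonal_ranClosure (hA : IsConjSymmetric A) {f : H2} :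
    f ∈ (ranClosure A)ᗮ ↔ A f = 0 := by
  rw [ranClosure, Submodule.orthogonal_closure, Submodule.mem_orthogonal]
  constructor
  · intro h
    have := h (A (A f)) ⟨A f, rfl⟩
    rwa [hA, inner_self_eq_zero] at this
  · rintro h _ ⟨g, rfl⟩
    change inner ℂ (A g) f = 0
    rw [hA, h, inner_zero_left]

theorem IsConjSymmetric.eq_zero_of_apply_eq_zero (hA : IsConjSymmetric A) {f : H2}
    (hf : f ∈ ranClosure A) (h : A f = 0) : f = 0 := by
  have := (Submodule.mem_orthogonal _ _).1 (hA.mem_orthogonal_ranClosure.2 h) f hf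
  rwa [inner_self_eq_zero] at this

/-- `|A|` is self-adjoint and vanishes on the kernel of `A`, which is the orthogonal complement of
the range. -/
theorem IsConjSymmetric.modulus_mem_ranClosure (hA : IsConjSymmetric A) (f : H2) :
    modulus A f ∈ ranClosure A := by
  rw [← Submodule.orthogonal_orthogonal (ranClosure A), Submodule.mem_orthogonal]
  intro g hg
  have h0 : modulus A g = 0 := by
    rw [← norm_eq_zero, hA.norm_modulus, hA.mem_orthogonal_ranClosure.1 hg, norm_zero]
  have h := (isSelfAdjoint_opSqrt (sqOp A)).isSymmetric g f
  change inner ℂ (modulus A g) f = inner ℂ g (modulus A f) at h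
  rw [← h, h0, inner_zero_left]

theorem cyclicSubspace_sqOp_le_modulus (hA : IsConjSymmetric A) (v : H2) :
    cyclicSubspace (sqOp A) v ≤ cyclicSubspace (modulus A) v := by
  refine cyclicSubspace_le (Submodule.isClosed_topologicalClosure _)
    (self_mem_cyclicSubspace _ _) fun x hx => ?_
  rw [← opSqrt_mul_self hA.sqOp_nonneg]
  exact map_cyclicSubspace (map_cyclicSubspace hx)

/-- If the square of a symmetric anti-linear operator `A` has simple spectrum on `X`, then every
closed subspace of `X` that is invariant under the square of `A` is invariant under `A`. -/
theorem IsConjSymmetric.map_mem_of_simple (hA : IsConjSymmetric A) {X Y : Submodule ℂ H2}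
    (hX : SimpleSpectrumOn (sqOp A) X) (hAX : ∀ x ∈ X, A x ∈ X) (hY : IsClosed (Y : Set H2))
    (hYX : Y ≤ X) (hTY : ∀ y ∈ Y, sqOp A y ∈ Y) {y : H2} (hy : y ∈ Y) : A y ∈ Y := by
  obtain ⟨v, hv, hvX⟩ := hX
  have : CompleteSpace Y := hY.completeSpace_coe
  have hT := hA.isSelfAdjoint_sqOp
  let Q : H2 →L[ℂ] H2 := Y.starProjection
  have hQmem : ∀ f, Q f ∈ Y := fun f => Submodule.starProjection_apply_mem Y f
  -- An invariant subspace of a self-adjoint operator is reducing.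
  have hQT : ∀ f, Q (sqOp A f) = sqOp A (Q f) := by
    intro f
    have h1 : Q (sqOp A (Q f)) = sqOp A (Q f) :=
      Submodule.starProjection_eq_self_iff.2 (hTY _ (hQmem f))
    have h2 : Q (sqOp A (f - Q f)) = 0 := by
      refine (Submodule.starProjection_apply_eq_zero_iff Y).2 ?_
      rw [Submodule.mem_orthogonal]
      intro z hz
      have h := hT.isSymmetric z (f - Q f)
      rw [ContinuousLinearMap.coe_coe] at h
      rw [← h]
      exact (Submodule.mem_orthogonal _ _).1 (Submodule.sub_starProjection_mem_orthogonal f) _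
        (hTY z hz)
    rw [map_sub, map_sub, h1, sub_eq_zero] at h2
    exact h2
  have hQs : ∀ f g, inner ℂ (Q f) g = inner ℂ f (Q g) := fun f g =>
    Submodule.inner_starProjection_left_eq_right Y f g
  have hAT : ∀ f, A (sqOp A f) = sqOp A (A f) := fun _ => rfl
  -- Pairing with `r(A²) v` gives `⟨A v, r(A²) Q v⟩` for both sides. Their difference lies in `X`,
  -- where these vectors are dense.
  have hAQv : A (Q v) = Q (A v) := by
    have hd : A (Q v) - Q (A v) ∈ cyclicSubspace (sqOp A) v := by
      rw [hvX]
      exact sub_mem (hAX _ (hYX (hQmem v))) (hYX (hQmem _))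
    have h0 := eqOn_cyclicSubspace (f := fun x => inner ℂ (A (Q v) - Q (A v)) x)
      (g := fun _ => (0 : ℂ)) (by fun_prop) (by fun_prop) (fun r => ?_) hd
    · rwa [inner_self_eq_zero, sub_eq_zero] at h0
    · rw [inner_sub_left, hA, map_orbitMap_of_conj hAT, inner_orbitMap_conj hT, hQs,
        map_orbitMap hQT, sub_self]
  have hyX : y ∈ cyclicSubspace (sqOp A) v := by rw [hvX]; exact hYX hy
  -- The commutation spreads from `v` to all of `X`, because `A` and `Q` both commute with `A²`.
  have h := eqOn_cyclicSubspace (f := fun x => A (Q x)) (g := fun x => Q (A x))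
    (by fun_prop) (by fun_prop) (fun p => by
      rw [map_orbitMap hQT, map_orbitMap_of_conj hAT, map_orbitMap_of_conj hAT, hAQv,
        map_orbitMap hQT]) hyX
  have hQy : Q y = y := Submodule.starProjection_eq_self_iff.2 hy
  rw [← hQy]
  change A (Q y) ∈ Y
  rw [h]
  exact hQmem _

end ConjSymmetric

/-! ### Cyclicity of the symbol -/

section Cyclicity

variable {u : H2} {H : H2 →SL[starRingEnd ℂ] H2}

theorem ranClosure_truncated_le (H : H2 →SL[starRingEnd ℂ] H2) :
    ranClosure (truncated H) ≤ ranClosure H := by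
  refine Submodule.topologicalClosure_mono ?_
  rintro _ ⟨f, rfl⟩
  exact ⟨shift f, rfl⟩

theorem IsHankel.mem_ranClosure (hH : IsHankel u H) : u ∈ ranClosure H := by
  rw [← hH.map_one]; exact apply_mem_ranClosure H oneH2

/-- If the squares of `H_u` and of its truncation have simple spectrum on the closure of the range
of `H_u`, then `u` is a cyclic vector for the square of `H_u`. -/
theorem IsHankel.cyclicSubspace_sqOp (hH : IsHankel u H)
    (h1 : SimpleSpectrumOn (sqOp H) (ranClosure H))
    (h2 : SimpleSpectrumOn (sqOp (truncated H)) (ranClosure H)) :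
    cyclicSubspace (sqOp H) u = ranClosure H := by
  have hs := hH.isConjSymmetric
  have hst := hH.isConjSymmetric_truncated
  set X := ranClosure H with hX
  set Y := cyclicSubspace (sqOp H) u with hY
  have hYc : IsClosed (Y : Set H2) := Submodule.isClosed_topologicalClosure _
  have : CompleteSpace Y := hYc.completeSpace_coe
  have hYX : Y ≤ X := cyclicSubspace_le (isClosed_ranClosure H) hH.mem_ranClosure
    fun x _ => apply_mem_ranClosure H (H x)
  have huY : u ∈ Y := self_mem_cyclicSubspace _ _
  have hHY : ∀ y ∈ Y, H y ∈ Y := fun y hy =>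
    hs.map_mem_of_simple h1 (fun x _ => apply_mem_ranClosure H x) hYc hYX
      (fun _ => map_cyclicSubspace) hy
  have hHtY : ∀ y ∈ Y, truncated H y ∈ Y := fun y hy =>
    hst.map_mem_of_simple h2 (fun x _ => apply_mem_ranClosure H (shift x)) hYc hYX
      (fun y hy => by
        rw [hH.sqOp_truncated]
        exact sub_mem (map_cyclicSubspace hy) (Submodule.smul_mem _ _ huY)) hy
  set Z := Yᗮ ⊓ X with hZ
  have hZc : IsClosed (Z : Set H2) := (Submodule.isClosed_orthogonal Y).inter (isClosed_ranClosure H)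
  -- Symmetry passes invariance from `Y` to its orthogonal complement.
  have horth : ∀ A : H2 →SL[starRingEnd ℂ] H2, IsConjSymmetric A → (∀ y ∈ Y, A y ∈ Y) →
      ∀ z ∈ Z, A z ∈ Yᗮ := by
    intro A hA hAY z hz
    rw [Submodule.mem_orthogonal']
    intro y hy
    rw [hA]
    exact (Submodule.mem_orthogonal _ _).1 hz.1 _ (hAY y hy)
  have hHZ : ∀ z ∈ Z, H z ∈ Z := fun z hz => ⟨horth H hs hHY z hz, apply_mem_ranClosure H z⟩
  have hHtZ : ∀ z ∈ Z, truncated H z ∈ Z := fun z hz =>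
    ⟨horth _ hst hHtY z hz, apply_mem_ranClosure H (shift z)⟩
  let W : Submodule ℂ H2 := (Z.map (H : H2 →ₛₗ[starRingEnd ℂ] H2)).topologicalClosure
  have hWc : IsClosed (W : Set H2) := Submodule.isClosed_topologicalClosure _
  have : CompleteSpace W := hWc.completeSpace_coe
  have hmemW : ∀ z ∈ Z, H z ∈ W := fun z hz =>
    Submodule.le_topologicalClosure _ ⟨z, hz, rfl⟩
  have hWZ : W ≤ Z := by
    refine Submodule.topologicalClosure_minimal _ ?_ hZc
    rintro _ ⟨z, hz, rfl⟩
    exact hHZ z hz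
  -- `H` has dense range in `Z`: a vector of `Z` orthogonal to `H Z` is killed by `H`, and `H` is
  -- injective on `X`.
  have hZW : Z ≤ W := by
    have h := Submodule.sup_orthogonal_inf_of_hasOrthogonalProjection hWZ
    suffices h0 : Wᗮ ⊓ Z = ⊥ by rw [h0, sup_bot_eq] at h; exact h.ge
    rw [Submodule.eq_bot_iff]
    rintro z ⟨hzW, hz⟩
    refine hs.eq_zero_of_apply_eq_zero hz.2 ?_
    have h3 := (Submodule.mem_orthogonal _ _).1 hzW _ (hmemW _ (hHZ z hz))
    rwa [hs, inner_self_eq_zero] at h3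
  -- By density it suffices to take `z = H w`: then `S* H w = H̃ w` is in `Z`, and `⟨H w, 1⟩ = ⟨H 1,
  -- w⟩ = ⟨u, w⟩ = 0` since `u ∈ Y`.
  have hZ2 : ∀ z ∈ Z, backShift z ∈ Z ∧ inner ℂ oneH2 z = 0 := by
    intro z hz
    have hc : IsClosed {z : H2 | backShift z ∈ Z ∧ inner ℂ oneH2 z = 0} :=
      (hZc.preimage backShift.continuous).inter (isClosed_eq (by fun_prop) continuous_const)
    have hz' : z ∈ closure (Z.map (H : H2 →ₛₗ[starRingEnd ℂ] H2) : Set H2) := hZW hz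
    refine closure_minimal ?_ hc hz'
    rintro _ ⟨w, hw, rfl⟩
    refine ⟨?_, ?_⟩
    · change backShift (H w) ∈ Z
      rw [← hH.map_shift]
      exact hHtZ w hw
    · change inner ℂ oneH2 (H w) = 0
      rw [← inner_conj_symm, hs, hH.map_one, (Submodule.mem_orthogonal _ _).1 hw.1 u huY, map_zero]
  have hZbot : Z = ⊥ := by
    rw [Submodule.eq_bot_iff]
    intro z hz
    refine ext_shift_pow fun k => ?_
    rw [inner_zero_right, inner_shift_pow_oneH2]
    have hk : (backShift ^ k) z ∈ Z := by
      induction k with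
      | zero => exact hz
      | succ k ih => rw [pow_succ', mul_apply_eq_comp]; exact (hZ2 _ ih).1
    exact (hZ2 _ hk).2
  have h := Submodule.sup_orthogonal_inf_of_hasOrthogonalProjection hYX
  rwa [← hZ, hZbot, sup_bot_eq] at h

theorem IsHankel.cyclicSubspace_modulus (hH : IsHankel u H)
    (h1 : SimpleSpectrumOn (sqOp H) (ranClosure H))
    (h2 : SimpleSpectrumOn (sqOp (truncated H)) (ranClosure H)) :
    cyclicSubspace (modulus H) u = ranClosure H := by
  refine le_antisymm (cyclicSubspace_le (isClosed_ranClosure H) hH.mem_ranClosure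
    fun x _ => hH.isConjSymmetric.modulus_mem_ranClosure x) ?_
  rw [← hH.cyclicSubspace_sqOp h1 h2]
  exact cyclicSubspace_sqOp_le_modulus hH.isConjSymmetric u

/-- Since `H² = H̃² + ⟨·, u⟩ u`, the cyclic subspace of `H̃²` at `u` is invariant under `H²` and so
contains the cyclic subspace of `H²`. -/
theorem IsHankel.cyclicSubspace_modulus_truncated (hH : IsHankel u H)
    (h1 : SimpleSpectrumOn (sqOp H) (ranClosure H))
    (h2 : SimpleSpectrumOn (sqOp (truncated H)) (ranClosure H)) :
    cyclicSubspace (modulus (truncated H)) u = ranClosure H := by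
  refine le_antisymm (cyclicSubspace_le (isClosed_ranClosure H) hH.mem_ranClosure
    fun x _ => ranClosure_truncated_le H
      (hH.isConjSymmetric_truncated.modulus_mem_ranClosure x)) ?_
  rw [← hH.cyclicSubspace_sqOp h1 h2]
  refine le_trans ?_ (cyclicSubspace_sqOp_le_modulus hH.isConjSymmetric_truncated u)
  refine cyclicSubspace_le (Submodule.isClosed_topologicalClosure _)
    (self_mem_cyclicSubspace _ _) fun x hx => ?_
  rw [← sub_add_cancel (sqOp H x) (inner ℂ u x • u), ← hH.sqOp_truncated]
  exact add_mem (map_cyclicSubspace hx) (Submodule.smul_mem _ _ (self_mem_cyclicSubspace _ _))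

end Cyclicity

/-! ### Complex conjugation and the operator `M̃` -/

section Conjugation

/-- Complex conjugation on `L²(ρ)`. -/
def conjL2 (ρ : Measure ℝ) : Lp ℂ 2 ρ →SL[starRingEnd ℂ] Lp ℂ 2 ρ :=
  ((starₗᵢ ℂ : ℂ ≃ₗᵢ⋆[ℂ] ℂ).toContinuousLinearEquiv : ℂ →SL[starRingEnd ℂ] ℂ).compLpL 2 ρ

theorem coeFn_conjL2 {ρ : Measure ℝ} (f : Lp ℂ 2 ρ) :
    conjL2 ρ f =ᵐ[ρ] fun s => conj (f s) :=
  ContinuousLinearMap.coeFn_compLpL _ f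

theorem eval_map_conj (p : ℂ[X]) (s : ℝ) :
    (p.map (starRingEnd ℂ)).eval (s : ℂ) = conj (p.eval (s : ℂ)) := by
  conv_lhs => rw [← Complex.conj_ofReal s]
  exact eval_map_apply _ _

variable {ρ : Measure ℝ}

theorem inner_conjL2 (f g : Lp ℂ 2 ρ) :
    inner ℂ (conjL2 ρ f) (conjL2 ρ g) = conj (inner ℂ f g) := by
  rw [L2.inner_def, L2.inner_def, ← integral_conj]
  refine integral_congr_ae ?_
  filter_upwards [coeFn_conjL2 f, coeFn_conjL2 g] with s h1 h2
  rw [h1, h2]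
  simp

theorem conjL2_opM (hρ : MemLp (fun s : ℝ => (s : ℂ)) ∞ ρ) (f : Lp ℂ 2 ρ) :
    conjL2 ρ (opM ρ f) = opM ρ (conjL2 ρ f) := by
  refine Lp.ext ?_
  filter_upwards [coeFn_conjL2 (opM ρ f), coeFn_conjL2 f, coeFn_opM hρ f,
    coeFn_opM hρ (conjL2 ρ f)] with s h1 h2 h3 h4
  rw [h1, h3, h4, h2, map_mul, Complex.conj_ofReal]

variable [IsFiniteMeasure ρ]

theorem conjL2_oneL2 : conjL2 ρ (oneL2 ρ) = oneL2 ρ := by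
  refine Lp.ext ?_
  filter_upwards [coeFn_conjL2 (oneL2 ρ), coeFn_oneL2 (ρ := ρ)] with s h1 h2
  rw [h1, h2, map_one]

theorem isSelfAdjoint_opM_sq_sub (hρ : MemLp (fun s : ℝ => (s : ℂ)) ∞ ρ) :
    IsSelfAdjoint (opM ρ ^ 2 - InnerProductSpace.rankOne ℂ (oneL2 ρ) (oneL2 ρ)) :=
  ((isSelfAdjoint_opM hρ).pow 2).sub
    (ContinuousLinearMap.isSelfAdjoint_iff_isSymmetric.2
      (InnerProductSpace.isSymmetric_rankOne_self _))

theorem opM_sq_sub_apply (f : Lp ℂ 2 ρ) :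
    (opM ρ ^ 2 - InnerProductSpace.rankOne ℂ (oneL2 ρ) (oneL2 ρ)) f
      = opM ρ (opM ρ f) - inner ℂ (oneL2 ρ) f • oneL2 ρ := by
  rw [_root_.sub_apply, InnerProductSpace.rankOne_apply, pow_two, mul_apply_eq_comp]

theorem isSelfAdjoint_opMt (ρ : Measure ℝ) [IsFiniteMeasure ρ] : IsSelfAdjoint (opMt ρ) :=
  isSelfAdjoint_opSqrt _

/-- Complex conjugation as a real-linear operator. -/
def conjRealL2 (ρ : Measure ℝ) : Lp ℂ 2 ρ →L[ℝ] Lp ℂ 2 ρ where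
  toFun := conjL2 ρ
  map_add' := (conjL2 ρ).map_add
  map_smul' r f := by
    rw [RCLike.real_smul_eq_coe_smul (K := ℂ), RCLike.real_smul_eq_coe_smul (K := ℂ), map_smulₛₗ]
    simp
  cont := (conjL2 ρ).continuous

/-- `M² - ⟨·, 𝟙⟩ 𝟙` is a real operator, and so is its square root. -/
theorem conjL2_opMt (hρ : MemLp (fun s : ℝ => (s : ℂ)) ∞ ρ) (f : Lp ℂ 2 ρ) :
    conjL2 ρ (opMt ρ f) = opMt ρ (conjL2 ρ f) := by
  refine map_cfc_of_intertwine (conjRealL2 ρ) (isSelfAdjoint_opM_sq_sub hρ)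
    (isSelfAdjoint_opM_sq_sub hρ) (fun f => ?_) Real.continuous_sqrt f
  change conjL2 ρ (_ : Lp ℂ 2 ρ) = (_ : Lp ℂ 2 ρ →L[ℂ] Lp ℂ 2 ρ) (conjL2 ρ f)
  have h : inner ℂ (oneL2 ρ) (conjL2 ρ f) = conj (inner ℂ (oneL2 ρ) f) := by
    rw [← inner_conjL2, conjL2_oneL2]
  rw [opM_sq_sub_apply, opM_sq_sub_apply, map_sub, map_smulₛₗ, conjL2_oneL2, conjL2_opM hρ,
    conjL2_opM hρ, h]

theorem rhoTilde_eq (ρ : Measure ℝ) [IsFiniteMeasure ρ] :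
    rhoTilde ρ = spectralMeasure (opMt ρ) (oneL2 ρ) := by rw [rhoTilde]

instance (ρ : Measure ℝ) [IsFiniteMeasure ρ] : IsFiniteMeasure (rhoTilde ρ) := by
  rw [rhoTilde_eq]; infer_instance

theorem memLp_top_coe_rhoTilde (ρ : Measure ℝ) [IsFiniteMeasure ρ] :
    MemLp (fun s : ℝ => (s : ℂ)) ∞ (rhoTilde ρ) := by
  rw [rhoTilde_eq]; exact memLp_top_coe_spectralMeasure _ _

theorem ae_nonneg_spectralMeasure {E : Type*} [NormedAddCommGroup E] [InnerProductSpace ℂ E]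
    [CompleteSpace E] {T : E →L[ℂ] E} (hT : 0 ≤ T) (v : E) :
    ∀ᵐ s ∂(spectralMeasure T v), 0 ≤ s := by
  filter_upwards [ae_mem_spectrum T v] with s hs
  exact spectrum_nonneg_of_nonneg hT hs

theorem ae_nonneg_rhoTilde (ρ : Measure ℝ) [IsFiniteMeasure ρ] :
    ∀ᵐ s ∂(rhoTilde ρ), 0 ≤ s := by
  rw [rhoTilde_eq]; exact ae_nonneg_spectralMeasure (opSqrt_nonneg _) _

/-- The spectral representation of `M̃` commutes with complex conjugation. -/
theorem IsSpectralUnitary.map_conjL2 (hρ : MemLp (fun s : ℝ => (s : ℂ)) ∞ ρ)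
    {V : Lp ℂ 2 (rhoTilde ρ) ≃ₗᵢ[ℂ] (⊤ : Submodule ℂ (Lp ℂ 2 ρ))}
    (hV : IsSpectralUnitary (opMt ρ) (oneL2 ρ) V) (h : Lp ℂ 2 (rhoTilde ρ)) :
    (V (conjL2 _ h) : Lp ℂ 2 ρ) = conjL2 ρ (V h : Lp ℂ 2 ρ) := by
  have hρt := memLp_top_coe_rhoTilde ρ
  refine congrFun (eq_of_eq_on_polynomials hρt
    (f := fun h => (V (conjL2 _ h) : Lp ℂ 2 ρ)) (g := fun h => conjL2 ρ (V h : Lp ℂ 2 ρ))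
    (by fun_prop) (by fun_prop) fun p => ?_) h
  rw [map_orbitMap_of_conj (conjL2_opM hρt), conjL2_oneL2, (isSpectralUnitary_iff hρt).1 hV,
    (isSpectralUnitary_iff hρt).1 hV, map_orbitMap_of_conj (conjL2_opMt hρ), conjL2_oneL2]

end Conjugation

/-! ### Transport of Hankel operators to `L²(ρ)` -/

section HankelModel

variable {u : H2} {A H : H2 →SL[starRingEnd ℂ] H2} {X : Submodule ℂ H2}
  {ρ : Measure ℝ}

/-- The vector `q = U⁻¹ P_X 1`. -/
def modelVector (H : H2 →SL[starRingEnd ℂ] H2) (U : Lp ℂ 2 ρ ≃ₗᵢ[ℂ] ranClosure H) :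
    Lp ℂ 2 ρ := U.symm ((ranClosure H).orthogonalProjectionOnto oneH2)

/-- `1 - P_X 1` is orthogonal to the range of `H`, hence in its kernel, and `H 1 = u`. -/
theorem IsHankel.map_modelVector (hH : IsHankel u H) (U : Lp ℂ 2 ρ ≃ₗᵢ[ℂ] ranClosure H) :
    H (U (modelVector H U)) = u := by
  have h : oneH2 - (ranClosure H).orthogonalProjectionOnto oneH2 ∈ (ranClosure H)ᗮ :=
    Submodule.sub_starProjection_mem_orthogonal oneH2
  rw [hH.isConjSymmetric.mem_orthogonal_ranClosure, map_sub, hH.map_one, sub_eq_zero] at h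
  rw [modelVector, LinearIsometryEquiv.apply_symm_apply, ← h]

theorem norm_modelVector_le (U : Lp ℂ 2 ρ ≃ₗᵢ[ℂ] ranClosure H) : ‖modelVector H U‖ ≤ 1 := by
  rw [modelVector, LinearIsometryEquiv.norm_map]
  refine (Submodule.norm_orthogonalProjectionOnto_apply_le _ _).trans (le_of_eq ?_)
  rw [Submodule.coe_norm]
  exact orthonormal_fourier.norm_eq_one 0

theorem inner_modelVector (U : Lp ℂ 2 ρ ≃ₗᵢ[ℂ] ranClosure H) (f : Lp ℂ 2 ρ) :
    inner ℂ (modelVector H U) f = inner ℂ oneH2 (U f : H2) := by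
  have h : inner ℂ (modelVector H U) f
      = inner ℂ (U (modelVector H U) : H2) (U f : H2) := (inner_ambient U _ _).symm
  rw [h, modelVector, LinearIsometryEquiv.apply_symm_apply]
  exact Submodule.inner_starProjection_left_eq_right _ _ _ |>.trans (by
    rw [Submodule.starProjection_eq_self_iff.2 (U f).2])

variable [IsFiniteMeasure ρ]

theorem IsSpectralUnitary.map_orbitMap_opM {E : Type*} [NormedAddCommGroup E]
    [InnerProductSpace ℂ E] {T : E →L[ℂ] E} {v : E} {X : Submodule ℂ E}
    (hρ : MemLp (fun s : ℝ => (s : ℂ)) ∞ ρ) {U : Lp ℂ 2 ρ ≃ₗᵢ[ℂ] X}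
    (hU : IsSpectralUnitary T v U) (f : Lp ℂ 2 ρ) (p : ℂ[X]) :
    (U (orbitMap (opM ρ) f p) : E) = orbitMap T (U f) p :=
  map_orbitMap (Q := X.subtypeL.comp (U.toContinuousLinearEquiv : Lp ℂ 2 ρ →L[ℂ] X))
    (fun f => hU.map_opM hρ f) f p

/-- In the spectral representation of its modulus, a symmetric anti-linear operator acts as
`f ↦ φ f̄` with `|φ(s)| = s`. -/
theorem IsConjSymmetric.exists_symbol (hA : IsConjSymmetric A)
    (hAX : ∀ x ∈ X, A x ∈ X) (hρ : MemLp (fun s : ℝ => (s : ℂ)) ∞ ρ) (hρ0 : ∀ᵐ s ∂ρ, 0 ≤ s)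
    {U : Lp ℂ 2 ρ ≃ₗᵢ[ℂ] X} (hU : IsSpectralUnitary (modulus A) u U) :
    ∃ φ : Lp ℂ 2 ρ, (∀ᵐ s ∂ρ, ‖φ s‖ = s) ∧
      ∀ f g : Lp ℂ 2 ρ, (g =ᵐ[ρ] fun s => φ s * conj (f s)) → A (U f) = U g := by
  let K : Lp ℂ 2 ρ → Lp ℂ 2 ρ := fun f => U.symm ⟨A (U f), hAX _ (U f).2⟩
  have hK : ∀ f, (U (K f) : H2) = A (U f) := fun f => by simp [K]
  have hKc : Continuous K := by
    refine U.symm.continuous.comp (Continuous.subtype_mk ?_ _)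
    fun_prop
  set φ := K (oneL2 ρ) with hφ
  have hKφ : ∀ f, K f =ᵐ[ρ] fun s => φ s * conj (f s) := by
    refine ae_eq_mul_conj hρ hKc fun p => ?_
    have h1 : K (orbitMap (opM ρ) (oneL2 ρ) p)
        = orbitMap (opM ρ) φ (p.map (starRingEnd ℂ)) := by
      refine U.injective (Subtype.ext ?_)
      rw [hK, hU.map_orbitMap_opM hρ, hU.map_orbitMap_opM hρ, hφ, hK,
        map_orbitMap_of_conj hA.map_modulus]
    rw [h1]
    filter_upwards [coeFn_orbitMap_opM_apply hρ φ (p.map (starRingEnd ℂ))] with s h2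
    rw [h2, eval_map_conj, mul_comm]
  -- `A² = |A|²` applied to `𝟙` reads `φ φ̄ = s²`, which fixes the modulus of `φ`.
  have hA2 : K (K (oneL2 ρ)) = opM ρ (opM ρ (oneL2 ρ)) := by
    refine U.injective (Subtype.ext ?_)
    rw [hK, hK, hU.map_opM hρ, hU.map_opM hρ, ← mul_apply_eq_comp (modulus A)]
    change _ = (opSqrt (sqOp A) * opSqrt (sqOp A)) _
    rw [opSqrt_mul_self hA.sqOp_nonneg, sqOp_apply]
  refine ⟨φ, ?_, fun f g hg => ?_⟩
  · filter_upwards [hKφ φ, coeFn_opM hρ (opM ρ (oneL2 ρ)), coeFn_opM hρ (oneL2 ρ),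
      coeFn_oneL2 (ρ := ρ), hρ0] with s h1 h2 h3 h4 h5
    rw [hφ, hA2, h2, h3, h4, ← hφ, Complex.mul_conj, Complex.normSq_eq_norm_sq] at h1
    have h6 : s ^ 2 = ‖φ s‖ ^ 2 := by
      have : ((s ^ 2 : ℝ) : ℂ) = ((‖φ s‖ ^ 2 : ℝ) : ℂ) := by rw [← h1]; push_cast; ring
      exact_mod_cast this
    exact ((sq_eq_sq₀ h5 (norm_nonneg _)).1 h6).symm
  · rw [← hK, Lp.ext (hg.trans (hKφ f).symm)]

/-- `U` carries `M²` to `H²` and `𝟙` to `u`, so it matches the two rank-one perturbations, and then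
their square roots. -/
theorem IsHankel.map_opMt (hH : IsHankel u H) (hρ : MemLp (fun s : ℝ => (s : ℂ)) ∞ ρ)
    {U : Lp ℂ 2 ρ ≃ₗᵢ[ℂ] X} (hU : IsSpectralUnitary (modulus H) u U)
    (f : Lp ℂ 2 ρ) :
    (U (opMt ρ f) : H2) = modulus (truncated H) (U f) := by
  refine map_cfc_of_intertwine (ambientReal U) (isSelfAdjoint_opM_sq_sub hρ)
    hH.isConjSymmetric_truncated.isSelfAdjoint_sqOp (fun f => ?_) Real.continuous_sqrt f
  rw [ambientReal_apply, ambientReal_apply, ← ambientIsometry_apply]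
  have h1 : inner ℂ u (U f : H2) = inner ℂ (oneL2 ρ) f := by
    rw [← hU.map_one hρ, inner_ambient]
  rw [opM_sq_sub_apply, map_sub, map_smul, ambientIsometry_apply, ambientIsometry_apply,
    hU.map_opM hρ, hU.map_opM hρ, hU.map_one hρ, hH.sqOp_truncated, h1, ← mul_apply_eq_comp (modulus H)]
  change (opSqrt (sqOp H) * opSqrt (sqOp H)) _ - _ = _
  rw [opSqrt_mul_self hH.isConjSymmetric.sqOp_nonneg]

theorem IsHankel.rhoTilde_eq (hH : IsHankel u H) (hρ : MemLp (fun s : ℝ => (s : ℂ)) ∞ ρ)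
    {U : Lp ℂ 2 ρ ≃ₗᵢ[ℂ] X} (hU : IsSpectralUnitary (modulus H) u U) :
    rhoTilde ρ = spectralMeasure (modulus (truncated H)) u := by
  rw [HankelInverse.rhoTilde_eq, spectralMeasure, spectralMeasure]
  congr 1
  ext f
  rw [spectralFunctional_apply, spectralFunctional_apply]
  congr 1
  have h := map_cfc_of_intertwine (ambientReal U) (isSelfAdjoint_opMt ρ) (isSelfAdjoint_opSqrt _)
      (hH.map_opMt hρ hU) f.continuous (oneL2 ρ)
  rw [ambientReal_apply, ambientReal_apply, hU.map_one hρ] at h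
  rw [modulus]
  refine Eq.trans ?_ (congrArg (inner ℂ u) h)
  conv_rhs => rw [← hU.map_one hρ]
  exact (inner_ambient U _ _).symm

end HankelModel

/-! ### The multipliers `s Ψ̄` and `s Ψ̃` -/

section Weights

theorem memLp_top_weight (D : SpectralDatum) :
    MemLp (fun s : ℝ => (s : ℂ)) ∞ D.ρ := by
  obtain ⟨R, hR⟩ := D.bounded
  refine memLp_top_of_bound (by fun_prop) R ?_
  have h1 : ∀ᵐ s ∂D.ρ, s ∉ Set.Ioi R := measure_eq_zero_iff_ae_notMem.1 hR
  have h2 : ∀ᵐ s ∂D.ρ, s ∉ Set.Iic 0 := measure_eq_zero_iff_ae_notMem.1 D.pos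
  filter_upwards [h1, h2] with s h1 h2
  rw [Set.mem_Ioi, not_lt] at h1
  rw [Set.mem_Iic, not_le] at h2
  rwa [Complex.norm_real, Real.norm_of_nonneg h2.le]

theorem ae_pos (D : SpectralDatum) : ∀ᵐ s ∂D.ρ, 0 < s := by
  have h2 : ∀ᵐ s ∂D.ρ, s ∉ Set.Iic 0 := measure_eq_zero_iff_ae_notMem.1 D.pos
  filter_upwards [h2] with s h2
  rwa [Set.mem_Iic, not_le] at h2

/-- `Ψ̃` is controlled only on `(0, ∞)`; at `s = 0` the factor `s` makes its value irrelevant. -/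
theorem norm_weight_t (D : SpectralDatum) :
    ∀ᵐ s : ℝ ∂(rhoTilde D.ρ), ‖(s : ℂ) * D.Ψt s‖ = s := by
  have h := (ae_restrict_iff' measurableSet_Ioi).1 D.unimodular_t
  filter_upwards [h, ae_nonneg_rhoTilde D.ρ] with s h1 h2
  rcases h2.eq_or_lt with h0 | h0
  · simp [← h0]
  · rw [norm_mul, h1 h0, mul_one, Complex.norm_real, Real.norm_of_nonneg h2]

theorem memLp_top_weight_t (D : SpectralDatum) :
    MemLp (fun s : ℝ => (s : ℂ) * D.Ψt s) ∞ (rhoTilde D.ρ) := by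
  -- `D.Ψt` is a class for the restricted measure only; its strongly measurable representative is
  -- measurable for the whole of `ρ̃`.
  refine (memLp_top_coe_rhoTilde D.ρ).mono
    ((by fun_prop : Measurable fun s : ℝ => (s : ℂ)).aestronglyMeasurable.mul
      (Lp.stronglyMeasurable D.Ψt).aestronglyMeasurable) ?_
  filter_upwards [norm_weight_t D, ae_nonneg_rhoTilde D.ρ] with s h1 h2
  rw [h1, Complex.norm_real, Real.norm_of_nonneg h2]

theorem coeFn_mulOp_toLp {ρ : Measure ℝ} {w : ℝ → ℂ} (hw : MemLp w ∞ ρ) (f : Lp ℂ 2 ρ) :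
    mulOp hw.toLp f =ᵐ[ρ] fun s => w s * f s := by
  filter_upwards [coeFn_mulOp hw.toLp f, hw.coeFn_toLp] with s h1 h2
  rw [h1, h2]

theorem memLp_top_weight_conj (D : SpectralDatum) :
    MemLp (fun s : ℝ => (s : ℂ) * conj (D.Ψ s)) ∞ D.ρ := by
  refine (memLp_top_weight D).mono
    ((by fun_prop : Measurable fun s : ℝ => (s : ℂ)).aestronglyMeasurable.mul
      (Complex.continuous_conj.comp_aestronglyMeasurable (Lp.aestronglyMeasurable D.Ψ))) ?_
  filter_upwards [D.unimodular] with s h1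
  rw [norm_mul, RCLike.norm_conj, h1, mul_one]

end Weights

/-! ### Existence and uniqueness of the spectral datum -/

section Existence

variable {u : H2}

theorem exists_isSpectralDatum (hu : u ∈ BMOASimp) : ∃ D, IsSpectralDatum u D := by
  obtain ⟨-, H, hH, h1, h2⟩ := hu
  have hs := hH.isConjSymmetric
  have hst := hH.isConjSymmetric_truncated
  have hρ := memLp_top_coe_spectralMeasure (modulus H) u
  have hρ0 : ∀ᵐ s ∂(spectralMeasure (modulus H) u), 0 ≤ s :=
    ae_nonneg_spectralMeasure (opSqrt_nonneg _) u
  obtain ⟨U, hU⟩ := exists_isSpectralUnitary (isSelfAdjoint_opSqrt (sqOp H))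
    (hH.cyclicSubspace_modulus h1 h2)
  change Lp ℂ 2 (spectralMeasure (modulus H) u) ≃ₗᵢ[ℂ] ranClosure H at U
  change IsSpectralUnitary (modulus H) u U at hU
  have hρt := hH.rhoTilde_eq hρ hU
  obtain ⟨Ut, hUt⟩ : ∃ Ut : Lp ℂ 2 (rhoTilde (spectralMeasure (modulus H) u)) ≃ₗᵢ[ℂ]
      ranClosure H, IsSpectralUnitary (modulus (truncated H)) u Ut := by
    rw [hρt]
    exact exists_isSpectralUnitary (isSelfAdjoint_opSqrt _)
      (hH.cyclicSubspace_modulus_truncated h1 h2)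
  obtain ⟨φ, hφ, hφU⟩ := hs.exists_symbol (fun x _ => apply_mem_ranClosure H x) hρ hρ0 hU
  obtain ⟨φt, hφt, hφUt⟩ := hst.exists_symbol
    (fun x _ => apply_mem_ranClosure H (shift x)) (memLp_top_coe_rhoTilde _)
    (ae_nonneg_rhoTilde _) hUt
  -- `H U q = u` reads `φ q̄ = 1`. With `|φ| = s` this excludes an atom at `0` and gives `|q| = 1 /
  -- s`.
  have hpos : ∀ᵐ s ∂(spectralMeasure (modulus H) u), 0 < s ∧ ‖modelVector H U s‖ = 1 / s := by
    have hw : MemLp (fun s => φ s) ∞ (spectralMeasure (modulus H) u) := by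
      refine hρ.mono (Lp.aestronglyMeasurable φ) ?_
      filter_upwards [hφ, hρ0] with s h3 h4
      rw [h3, Complex.norm_real, Real.norm_of_nonneg h4]
    have h3 : mulOp hw.toLp (conjL2 _ (modelVector H U)) = oneL2 _ := by
      refine U.injective (Subtype.ext ?_)
      rw [hU.map_one hρ, ← hφU (modelVector H U), hH.map_modelVector]
      filter_upwards [coeFn_mulOp_toLp hw (conjL2 _ (modelVector H U)),
        coeFn_conjL2 (modelVector H U)] with s h4 h5
      rw [h4, h5]
    have h4 := coeFn_mulOp_toLp hw (conjL2 _ (modelVector H U))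
    rw [h3] at h4
    filter_upwards [h4, coeFn_conjL2 (modelVector H U), coeFn_oneL2, hφ, hρ0] with s h4 h5 h6 h7 h8
    rw [h5, h6] at h4
    have h9 := congrArg norm h4
    rw [norm_one, norm_mul, RCLike.norm_conj, h7] at h9
    have h10 : s ≠ 0 := fun h => by rw [h, zero_mul] at h9; exact one_ne_zero h9
    exact ⟨h8.lt_of_ne' h10, by field_simp; linarith⟩
  have hΨn : ∀ᵐ s ∂(spectralMeasure (modulus H) u), ‖conj (φ s) / (s : ℂ)‖ = 1 := by
    filter_upwards [hpos, hφ] with s h3 h4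
    rw [norm_div, RCLike.norm_conj, h4, Complex.norm_real, Real.norm_of_nonneg h3.1.le,
      div_self h3.1.ne']
  have hΨ : MemLp (fun s : ℝ => conj (φ s) / (s : ℂ)) ∞ (spectralMeasure (modulus H) u) := by
    refine memLp_top_of_bound ?_ 1 (hΨn.mono fun s hs => hs.le)
    exact ((Complex.continuous_conj.comp_aestronglyMeasurable
      (Lp.aestronglyMeasurable φ)).aemeasurable.div (by fun_prop)).aestronglyMeasurable
  have hΨtn : ∀ᵐ s ∂((rhoTilde (spectralMeasure (modulus H) u)).restrict (Set.Ioi 0)),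
      ‖φt s / (s : ℂ)‖ = 1 := by
    filter_upwards [ae_restrict_of_ae hφt, ae_restrict_mem measurableSet_Ioi] with s h3 h4
    have h5 : 0 < s := h4
    rw [norm_div, h3, Complex.norm_real, Real.norm_of_nonneg h5.le, div_self h5.ne']
  have hΨt : MemLp (fun s : ℝ => φt s / (s : ℂ)) ∞
      ((rhoTilde (spectralMeasure (modulus H) u)).restrict (Set.Ioi 0)) := by
    refine memLp_top_of_bound ?_ 1 (hΨtn.mono fun s hs => hs.le)
    exact ((Lp.aestronglyMeasurable φt).aemeasurable.restrict.div
      (by fun_prop)).aestronglyMeasurable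
  let D : SpectralDatum :=
    { ρ := spectralMeasure (modulus H) u
      pos := by
        rw [measure_eq_zero_iff_ae_notMem]
        filter_upwards [hpos] with s hs
        exact not_le.2 hs.1
      bounded := by
        obtain ⟨R, hR⟩ := (spectrum.isCompact (𝕜 := ℝ) (modulus H)).isBounded.exists_norm_le
        refine ⟨R, measure_eq_zero_iff_ae_notMem.2 ?_⟩
        filter_upwards [ae_mem_spectrum (modulus H) u] with s hs
        exact not_lt.2 ((le_abs_self s).trans (hR s hs))
      normalized := by
        -- The integral is `‖q‖² = ‖P_X 1‖² ≤ 1`.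
        have h3 : ∫⁻ s, ENNReal.ofReal (1 / s ^ 2) ∂(spectralMeasure (modulus H) u)
            = ∫⁻ s, ‖modelVector H U s‖ₑ ^ (2 : ℝ) ∂(spectralMeasure (modulus H) u) := by
          refine lintegral_congr_ae ?_
          filter_upwards [hpos] with s hs
          rw [← ofReal_norm, hs.2, ENNReal.ofReal_rpow_of_pos (by
            have := hs.1; positivity)]
          congr 1
          norm_num
        have h4 : eLpNorm (modelVector H U) 2 (spectralMeasure (modulus H) u) ≤ 1 := by
          have h5 := norm_modelVector_le U
          rw [Lp.norm_def] at h5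
          rw [← ENNReal.ofReal_toReal (Lp.eLpNorm_ne_top (modelVector H U))]
          exact ENNReal.ofReal_le_one.2 h5
        rw [h3, ← ENNReal.toReal_ofNat 2, lintegral_rpow_enorm_eq_rpow_eLpNorm']
        · rw [← eLpNorm_eq_eLpNorm' (by norm_num) (by norm_num)]
          exact ENNReal.rpow_le_one h4 (by norm_num)
        · norm_num
      Ψ := hΨ.toLp
      unimodular := by
        filter_upwards [hΨ.coeFn_toLp, hΨn] with s h3 h4
        rw [h3, h4]
      Ψt := hΨt.toLp
      unimodular_t := by
        filter_upwards [hΨt.coeFn_toLp, hΨtn] with s h3 h4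
        rw [h3, h4] }
  refine ⟨D, H, U, Ut, hH, rfl, hρt, hU, hUt, fun f g hg => hφU f g ?_,
    fun f g hg => hφUt f g ?_⟩
  · filter_upwards [hg, hΨ.coeFn_toLp, hpos] with s h3 h4 h5
    have h6 : (s : ℂ) ≠ 0 := by exact_mod_cast h5.1.ne'
    rw [h3]
    change (s : ℂ) * conj ((hΨ.toLp _ : ℝ → ℂ) s) * _ = _
    rw [h4, map_div₀, Complex.conj_conj, Complex.conj_ofReal, mul_div_cancel₀ _ h6]
  · have h := (ae_restrict_iff' measurableSet_Ioi).1 hΨt.coeFn_toLp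
    filter_upwards [hg, h, hφt, ae_nonneg_rhoTilde (spectralMeasure (modulus H) u)]
      with s h3 h4 h5 h6
    rw [h3]
    change (s : ℂ) * (hΨt.toLp _ : ℝ → ℂ) s * _ = _
    rcases h6.eq_or_lt with h0 | h0
    · have h7 : φt s = 0 := by rw [← norm_eq_zero, h5, ← h0]
      rw [h7, ← h0]
      simp
    · have h6 : (s : ℂ) ≠ 0 := by exact_mod_cast h0.ne'
      rw [h4 h0, mul_div_cancel₀ _ h6]

theorem IsSpectralDatum.unique {D D' : SpectralDatum} (hD : IsSpectralDatum u D)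
    (hD' : IsSpectralDatum u D') : D = D' := by
  obtain ⟨H, U, Ut, hH, e1, e2, hU, hUt, h1, h2⟩ := hD
  obtain ⟨H', U', Ut', hH', e1', e2', hU', hUt', h1', h2'⟩ := hD'
  obtain rfl := hH.unique hH'
  have hρ := memLp_top_weight D
  have hw := memLp_top_weight_conj D
  have hw' := memLp_top_weight_conj D'
  have hwt := memLp_top_weight_t D
  have hwt' := memLp_top_weight_t D'
  have hpos := ae_pos D
  -- The measures must be identified first, since the types of `Ψ` and `Ψ̃` depend on them.
  obtain ⟨ρ, p1, p2, p3, Ψ, p4, Ψt, p5⟩ := D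
  obtain ⟨ρ', p1', p2', p3', Ψ', p4', Ψt', p5'⟩ := D'
  dsimp only at *
  obtain rfl : ρ = ρ' := e1.trans e1'.symm
  have hρt := memLp_top_coe_rhoTilde ρ
  obtain rfl := hU.unique hρ hU'
  obtain rfl := hUt.unique hρt hUt'
  -- Evaluation at `𝟙` recovers the weight of an operator `f ↦ w f̄`.
  have key : ∀ {μ : Measure ℝ} [IsFiniteMeasure μ] (V : Lp ℂ 2 μ ≃ₗᵢ[ℂ] ranClosure H)
      (A : H2 →SL[starRingEnd ℂ] H2) {w w' : ℝ → ℂ} (_ : MemLp w ∞ μ) (_ : MemLp w' ∞ μ)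
      (_ : ∀ f g : Lp ℂ 2 μ, (g =ᵐ[μ] fun s => w s * conj (f s)) → A (V f) = V g)
      (_ : ∀ f g : Lp ℂ 2 μ, (g =ᵐ[μ] fun s => w' s * conj (f s)) → A (V f) = V g),
      w =ᵐ[μ] w' := by
    intro μ _ V A w w' m m' k k'
    have a : ∀ {w : ℝ → ℂ} (m : MemLp w ∞ μ),
        mulOp m.toLp (oneL2 μ) =ᵐ[μ] fun s => w s * conj (oneL2 μ s) := by
      intro w m
      filter_upwards [coeFn_mulOp_toLp m (oneL2 μ), coeFn_oneL2 (ρ := μ)] with s b1 b2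
      rw [b1, b2, map_one]
    have b : mulOp m.toLp (oneL2 μ) = mulOp m'.toLp (oneL2 μ) :=
      V.injective (Subtype.ext ((k _ _ (a m)).symm.trans (k' _ _ (a m'))))
    have c := a m
    rw [b] at c
    filter_upwards [c, a m', coeFn_oneL2 (ρ := μ)] with s d1 d2 d3
    rw [d2, d3, map_one, mul_one, mul_one] at d1
    exact d1.symm
  obtain rfl : Ψ = Ψ' := by
    refine Lp.ext ?_
    filter_upwards [key U H hw hw' h1 h1', hpos] with s h3 h4
    have h6 : (s : ℂ) ≠ 0 := by exact_mod_cast h4.ne'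
    exact (starRingEnd ℂ).injective (mul_left_cancel₀ h6 h3)
  obtain rfl : Ψt = Ψt' := by
    refine Lp.ext ?_
    filter_upwards [ae_restrict_of_ae (key Ut (truncated H) hwt hwt' h2 h2'),
      ae_restrict_mem measurableSet_Ioi] with s h3 h4
    have h6 : (s : ℂ) ≠ 0 := by
      have : 0 < s := h4
      exact_mod_cast this.ne'
    exact mul_left_cancel₀ h6 h3
  rfl

end Existence

/-! ### Recovering the symbol from the datum -/

section Reconstruction

variable {u : H2} {D : SpectralDatum}

theorem backShift_mem_ranClosure {H : H2 →SL[starRingEnd ℂ] H2} (hH : IsHankel u H) {x : H2}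
    (hx : x ∈ ranClosure H) : backShift x ∈ ranClosure H := by
  have hx' : x ∈ closure (LinearMap.range (H : H2 →ₛₗ[starRingEnd ℂ] H2) : Set H2) := hx
  refine closure_mono ?_
    (image_closure_subset_closure_image backShift.continuous ⟨x, hx', rfl⟩)
  rintro _ ⟨_, ⟨f, rfl⟩, rfl⟩
  exact ⟨shift f, hH.map_shift f⟩

/-- The operator `Σ* = U⁻¹ S* U`. -/
def modelShift {H : H2 →SL[starRingEnd ℂ] H2} (hH : IsHankel u H) {ρ : Measure ℝ}
    (U : Lp ℂ 2 ρ ≃ₗᵢ[ℂ] ranClosure H) : Lp ℂ 2 ρ →L[ℂ] Lp ℂ 2 ρ :=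
  (U.symm.toContinuousLinearEquiv : ranClosure H →L[ℂ] Lp ℂ 2 ρ).comp
    ((backShift.restrict fun _ hx => backShift_mem_ranClosure hH hx).comp
      (U.toContinuousLinearEquiv : Lp ℂ 2 ρ →L[ℂ] ranClosure H))

theorem map_modelShift {H : H2 →SL[starRingEnd ℂ] H2} (hH : IsHankel u H) {ρ : Measure ℝ}
    (U : Lp ℂ 2 ρ ≃ₗᵢ[ℂ] ranClosure H) (f : Lp ℂ 2 ρ) :
    (U (modelShift hH U f) : H2) = backShift (U f) := by
  exact congrArg Subtype.val (U.apply_symm_apply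
    (backShift.restrict (fun _ hx => backShift_mem_ranClosure hH hx) (U f)))

theorem map_modelShift_pow {H : H2 →SL[starRingEnd ℂ] H2} (hH : IsHankel u H) {ρ : Measure ℝ}
    (U : Lp ℂ 2 ρ ≃ₗᵢ[ℂ] ranClosure H) (f : Lp ℂ 2 ρ) (k : ℕ) :
    (U ((modelShift hH U ^ k) f) : H2) = (backShift ^ k) (U f) := by
  induction k with
  | zero => simp
  | succ k ih => rw [pow_succ', pow_succ', mul_apply_eq_comp, mul_apply_eq_comp, map_modelShift, ih]

theorem norm_modelShift_le {H : H2 →SL[starRingEnd ℂ] H2} (hH : IsHankel u H) {ρ : Measure ℝ}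
    (U : Lp ℂ 2 ρ ≃ₗᵢ[ℂ] ranClosure H) : ‖modelShift hH U‖ ≤ 1 := by
  refine ContinuousLinearMap.opNorm_le_bound _ zero_le_one fun f => ?_
  rw [one_mul, ← U.norm_map, ← U.norm_map f, Submodule.coe_norm, Submodule.coe_norm,
    map_modelShift]
  exact norm_backShift_le _

/-- The values on the range of `M` are prescribed. That range is dense, because `M` is self-adjoint
and injective (`s > 0` almost everywhere). -/
theorem IsModelContraction.unique {A B : Lp ℂ 2 D.ρ →L[ℂ] Lp ℂ 2 D.ρ}
    (hA : IsModelContraction D A) (hB : IsModelContraction D B) : A = B := by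
  obtain ⟨V, hV, hVA⟩ := hA
  obtain ⟨V', hV', hVB⟩ := hB
  obtain rfl := hV.unique (memLp_top_coe_rhoTilde D.ρ) hV'
  have hρ := memLp_top_weight D
  have h1 : ∀ f, A (opM D.ρ f) = B (opM D.ρ f) := by
    intro f
    have hw := memLp_top_weight_t D
    let h := V.symm ⟨mulOp D.Ψ f, trivial⟩
    have h2 : (V h : Lp ℂ 2 D.ρ) = mulOp D.Ψ f := by simp [h]
    have h3 := coeFn_mulOp_toLp hw h
    rw [hVA f h _ h2 h3, hVB f h _ h2 h3]
  have h2 : DenseRange (opM D.ρ) := by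
    have h3 : (opM D.ρ).range.topologicalClosure = ⊤ := by
      rw [Submodule.topologicalClosure_eq_top_iff, Submodule.eq_bot_iff]
      intro f hf
      have h4 : opM D.ρ f = 0 := by
        have h5 := (Submodule.mem_orthogonal _ _).1 hf (opM D.ρ (opM D.ρ f)) ⟨_, rfl⟩
        have h6 := (isSelfAdjoint_opM hρ).isSymmetric (opM D.ρ f) f
        rw [ContinuousLinearMap.coe_coe] at h6
        rwa [h6, inner_self_eq_zero] at h5
      refine Lp.ext ?_
      have h5 := coeFn_opM hρ f
      rw [h4] at h5
      filter_upwards [h5, Lp.coeFn_zero ℂ 2 D.ρ, ae_pos D] with s h6 h7 h8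
      rw [h7, Pi.zero_apply] at h6 ⊢
      have h9 : (s : ℂ) ≠ 0 := by exact_mod_cast h8.ne'
      exact (mul_eq_zero.1 h6.symm).resolve_left h9
    exact (Submodule.dense_iff_topologicalClosure_eq_top).2 h3
  exact ContinuousLinearMap.ext
    (congrFun (h2.equalizer A.continuous B.continuous (funext h1)))

/-- `H U q = u` reads `s Ψ̄ q̄ = 1`; conjugate and use `|Ψ| = 1`. -/
theorem IsSpectralDatum.coeFn_modelVector (hD : IsSpectralDatum u D)
    {H : H2 →SL[starRingEnd ℂ] H2} (hH : IsHankel u H) {U : Lp ℂ 2 D.ρ ≃ₗᵢ[ℂ] ranClosure H}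
    (hU : IsSpectralUnitary (modulus H) u U) :
    modelVector H U =ᵐ[D.ρ] fun s => conj (D.Ψ s) / (s : ℂ) := by
  obtain ⟨H', U', Ut, hH', -, -, hU', -, h1, -⟩ := hD
  obtain rfl := hH.unique hH'
  obtain rfl := hU.unique (memLp_top_weight D) hU'
  have hw := memLp_top_weight_conj D
  have h2 : (mulOp hw.toLp (conjL2 _ (modelVector H U)) : Lp ℂ 2 D.ρ) =ᵐ[D.ρ]
      fun s => (s : ℂ) * conj (D.Ψ s) * conj (modelVector H U s) := by
    filter_upwards [coeFn_mulOp_toLp hw (conjL2 _ (modelVector H U)),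
      coeFn_conjL2 (modelVector H U)] with s h3 h4
    rw [h3, h4]
  have h3 : mulOp hw.toLp (conjL2 _ (modelVector H U)) = oneL2 D.ρ := by
    refine U.injective (Subtype.ext ?_)
    rw [hU.map_one (memLp_top_weight D), ← h1 _ _ h2, hH.map_modelVector]
  rw [h3] at h2
  filter_upwards [h2, coeFn_oneL2 (ρ := D.ρ), ae_pos D, D.unimodular] with s h4 h5 h6 h7
  rw [h5] at h4
  have h8 : (s : ℂ) ≠ 0 := by exact_mod_cast h6.ne'
  have h9 : conj (D.Ψ s) * D.Ψ s = 1 := by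
    rw [mul_comm, Complex.mul_conj, Complex.normSq_eq_norm_sq, h7]; norm_num
  have h10 := congrArg conj h4
  simp only [map_one, map_mul, Complex.conj_conj, Complex.conj_ofReal] at h10
  rw [eq_div_iff h8]
  calc modelVector H U s * s = (conj (D.Ψ s) * D.Ψ s) * (modelVector H U s * s) := by
        rw [h9, one_mul]
    _ = conj (D.Ψ s) * (s * D.Ψ s * modelVector H U s) := by ring
    _ = conj (D.Ψ s) := by rw [← h10, mul_one]

theorem IsSpectralDatum.isModelContraction (hD : IsSpectralDatum u D)
    {H : H2 →SL[starRingEnd ℂ] H2} (hH : IsHankel u H) {U : Lp ℂ 2 D.ρ ≃ₗᵢ[ℂ] ranClosure H}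
    (hU : IsSpectralUnitary (modulus H) u U) : IsModelContraction D (modelShift hH U) := by
  obtain ⟨H', U', Ut, hH', -, -, hU', hUt, h1, h2⟩ := hD
  obtain rfl := hH.unique hH'
  have hρ := memLp_top_weight D
  have hρt := memLp_top_coe_rhoTilde D.ρ
  obtain rfl := hU.unique hρ hU'
  -- `V = U⁻¹ Ũ` diagonalises `M̃`, since `U` intertwines `M̃` with `|H̃_u|`.
  let V : Lp ℂ 2 (rhoTilde D.ρ) ≃ₗᵢ[ℂ] (⊤ : Submodule ℂ (Lp ℂ 2 D.ρ)) :=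
    (Ut.trans U.symm).trans (LinearIsometryEquiv.ofTop (Lp ℂ 2 D.ρ) ⊤ rfl).symm
  have hUV : ∀ h, U (V h : Lp ℂ 2 D.ρ) = Ut h := fun h => U.apply_symm_apply (Ut h)
  have hV : IsSpectralUnitary (opMt D.ρ) (oneL2 D.ρ) V := by
    refine (isSpectralUnitary_iff hρt).2 fun p => U.injective (Subtype.ext ?_)
    rw [hUV, (isSpectralUnitary_iff hρt).1 hUt, ← ambientIsometry_apply]
    have h3 := map_orbitMap (T := opMt D.ρ) (S := modulus (truncated H))
      (Q := (ambientIsometry U).toContinuousLinearMap) (hH.map_opMt hρ hU) (oneL2 D.ρ) p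
    refine Eq.trans ?_ h3.symm
    exact congrArg (fun w => orbitMap (modulus (truncated H)) w p) (hU.map_one hρ).symm
  refine ⟨V, hV, fun f h g hh hg => U.injective (Subtype.ext ?_)⟩
  rw [map_modelShift, hUV]
  -- In the model `H` sends `conj (Ψ f)` to `s Ψ̄ Ψ f = s f`, so `S*` on the range of `M` is given
  -- by `H̃`.
  have h3 : H (U (conjL2 _ (mulOp D.Ψ f))) = U (opM D.ρ f) := by
    refine h1 _ _ ?_
    filter_upwards [coeFn_opM hρ f, coeFn_conjL2 (mulOp D.Ψ f), coeFn_mulOp D.Ψ f,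
      D.unimodular] with s h4 h5 h6 h7
    have h9 : conj (D.Ψ s) * D.Ψ s = 1 := by
      rw [mul_comm, Complex.mul_conj, Complex.normSq_eq_norm_sq, h7]; norm_num
    rw [h4, h5, h6, Complex.conj_conj]
    linear_combination (-(s : ℂ) * f s) * h9
  have h4 : (U (conjL2 _ (mulOp D.Ψ f)) : H2) = Ut (conjL2 _ h) := by
    rw [← hUV, hV.map_conjL2 hρ, hh]
  rw [← h3, ← hH.map_shift, h4]
  refine h2 _ _ ?_
  filter_upwards [hg, coeFn_conjL2 h] with s h5 h6
  rw [h5, h6, Complex.conj_conj]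

/-- `S*^k u` stays in `X`, so its pairing with `1` sees only `P_X 1 = U q`. -/
theorem hatCoeff_eq_inner_modelVector {H : H2 →SL[starRingEnd ℂ] H2} (hH : IsHankel u H)
    {ρ : Measure ℝ} [IsFiniteMeasure ρ] (hρ : MemLp (fun s : ℝ => (s : ℂ)) ∞ ρ)
    {U : Lp ℂ 2 ρ ≃ₗᵢ[ℂ] ranClosure H} (hU : IsSpectralUnitary (modulus H) u U) (k : ℕ) :
    hatCoeff u k = inner ℂ (modelVector H U) ((modelShift hH U ^ k) (oneL2 ρ)) := by
  rw [inner_modelVector, map_modelShift_pow, hU.map_one hρ, hatCoeff_eq_backShift]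

theorem hasSum_inner_resolvent {E : Type*} [NormedAddCommGroup E] [InnerProductSpace ℂ E]
    [CompleteSpace E] {T : E →L[ℂ] E} (hT : ‖T‖ ≤ 1) {z : ℂ} (hz : ‖z‖ < 1) (q v : E) :
    IsUnit (1 - z • T) ∧ HasSum (fun k : ℕ => inner ℂ q ((T ^ k) v) * z ^ k)
      (inner ℂ q (Ring.inverse (1 - z • T) v)) := by
  have h : ‖z • T‖ < 1 := by
    rw [norm_smul]
    exact (mul_le_of_le_one_right (norm_nonneg _) hT).trans_lt hz
  refine ⟨isUnit_one_sub_of_norm_lt_one h, ?_⟩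
  have h1 : HasSum (fun k : ℕ => (z • T) ^ k) (Ring.inverse (1 - z • T)) := by
    rw [NormedRing.inverse_one_sub _ h]
    exact (summable_geometric_of_norm_lt_one h).hasSum
  have h2 := h1.mapL ((innerSL ℂ q).comp (ContinuousLinearMap.apply ℂ E v))
  refine h2.congr_fun ?_
  intro k
  rw [_root_.smul_pow]
  change _ = inner ℂ q ((z ^ k • T ^ k) v)
  rw [_root_.smul_apply, inner_smul_right, mul_comm]

/-- The spectral datum determines the symbol. -/
theorem IsSpectralDatum.symbol_unique {u' : H2} (hD : IsSpectralDatum u D) (hD' : IsSpectralDatum u' D) : u = u' := by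
  obtain ⟨H, U, -, hH, -, -, hU, -⟩ := id hD
  obtain ⟨H', U', -, hH', -, -, hU', -⟩ := id hD'
  have hρ := memLp_top_weight D
  refine hatCoeff_injective fun k => ?_
  rw [hatCoeff_eq_inner_modelVector hH hρ hU, hatCoeff_eq_inner_modelVector hH' hρ hU',
    (hD.isModelContraction hH hU).unique (hD'.isModelContraction hH' hU'),
    Lp.ext ((hD.coeFn_modelVector hH hU).trans (hD'.coeFn_modelVector hH' hU').symm)]

end Reconstruction

end HankelInverse

end

/-! ### The spectral map and the inversion formula -/

theorem mainTheorem1 :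
    ∃ Λ : BMOASimp → SpectralDatum,
      (∀ (u : BMOASimp) (D : SpectralDatum), IsSpectralDatum (u : H2) D ↔ D = Λ u) ∧
      Function.Injective Λ ∧
      ∀ (u : BMOASimp) (H : H2 →SL[starRingEnd ℂ] H2)
        (U : Lp ℂ 2 (Λ u).ρ ≃ₗᵢ[ℂ] ranClosure H),
        IsHankel (u : H2) H → IsSpectralUnitary (modulus H) (u : H2) U →
        ∃ (q : Lp ℂ 2 (Λ u).ρ) (Sig : Lp ℂ 2 (Λ u).ρ →L[ℂ] Lp ℂ 2 (Λ u).ρ),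
          (q =ᵐ[(Λ u).ρ] fun s => conj ((Λ u).Ψ s) / (s : ℂ)) ∧
          (∀ f, (U (Sig f) : H2) = backShift (U f)) ∧
          IsModelContraction (Λ u) Sig ∧
          (∀ k : ℕ, hatCoeff (u : H2) k = inner ℂ q ((Sig ^ k) (oneL2 (Λ u).ρ))) ∧
          (∀ z : ℂ, ‖z‖ < 1 →
            IsUnit (1 - z • Sig) ∧
            HasSum (fun k : ℕ => hatCoeff (u : H2) k * z ^ k)
              (inner ℂ q ((Ring.inverse (1 - z • Sig)) (oneL2 (Λ u).ρ)))) := by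
  choose Λ hΛ using fun u : BMOASimp => exists_isSpectralDatum u.2
  refine ⟨Λ, fun u D => ⟨fun hD => hD.unique (hΛ u), fun h => h ▸ hΛ u⟩, fun u u' h => ?_,
    fun u H U hH hU => ⟨modelVector H U, modelShift hH U, (hΛ u).coeFn_modelVector hH hU,
      map_modelShift hH U, (hΛ u).isModelContraction hH hU,
      hatCoeff_eq_inner_modelVector hH (memLp_top_weight _) hU, fun z hz => ?_⟩⟩
  · exact Subtype.ext ((hΛ u).symbol_unique (h ▸ hΛ u'))
  · simp only [hatCoeff_eq_inner_modelVector hH (memLp_top_weight _) hU]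
    exact hasSum_inner_resolvent (norm_modelShift_le hH U) hz _ _
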